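/- Setting. Let $t\ge 2$ be a fixed integer. For integers $0\le k\le p$ let $\mathcal X_{p,k}=\{x\in\{0,1\}^p:\|x\|_0=k\}$, and let the Johnson graph $G_{p,k}$ be the graph on $\mathcal X_{p,k}$ in which $x,y$ are adjacent iff they differ in exactly two entries. In sparse $t$-tensor PCA with signal-to-noise ratio $\lambda=\lambda_p>0$ and sparsity $k=k_p$, the signal $v$ is uniform on $\mathcal X_{p,k}$ and one observes $$Y=\frac{\lambda}{k^{t/2}}\,v^{\otimes t}+W\in\mathbb R^{p^t},$$ where $W$ is independent of $v$ and has i.i.d. $N(0,1)$ entries. For $\beta\in\mathbb R$ let $\pi_\beta(x)\propto\exp\big(\beta\,k^{-t/2}\langle x^{\otimes t},Y\rangle\big)$, $x\in\mathcal X_{p,k}$. A Markov chain on $G_{p,k}$ is a discrete-time chain on $\mathcal X_{p,k}$ that in each step stays where it is or moves along an edge of $G_{p,k}$. Its mixing time is the least $n$ such that from every starting state the law after $n$ steps is within total variation distance $1/4$ of the stationary law ($\infty$ if there is no such $n$). Theorem 3.6 (Sparse Tensor PCA Model: Negative Result). There is an absolute constant $\alpha_0\in(0,1)$ such that the following holds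 as $p\to\infty$. Let $t\ge 2$ be constant and $k=k_p\to\infty$, and assume that either 1. $t=2$ and $k\le p^{\alpha_0}$ for all large $p$, or 2. $t\ge 3$ and $k=o\big(p^{\frac{t-2}{t+2}}\big)$. Suppose that $\lambda=\lambda_p>0$ satisfies $$\lambda=o\left(\frac1{\sqrt{\log(p/k)}}\min\left\{k^{t-\frac12},\ \frac{p^{t-1}}{k^{t-\frac32}}\right\}\right),$$ and let $b=b_p>0$ be any (deterministic) sequence with $$b=\omega\left(\lambda^{\frac1{t-1}}\,k^{\frac{t-2}{2(t-1)}}\,(\log(p/k))^{\frac{3t-2}{2(t-1)}}\right)\qquad\text{and}\qquad b=\omega\left(\sqrt{k\log(p/k)}\right).$$ (The second condition follows from the first whenever $\lambda\ge \sqrt{k}\,(\log(p/k))^{-(t-\frac12)}$.) Then there is a deterministic sequence $c_p\to\infty$ such that, with probability tending to $1$ over $(v,W)$, simultaneously for all $\beta\ge b_p$ and all Markov chains on $G_{p,k}$ that are reversible with respect to $\pi_\beta$, the mixing time of the chain is at least $p^{c_p}$; that is, it is $p^{\omega(1)}$. -/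

import Mathlib

open Filter Asymptotics MeasureTheory ProbabilityTheory
open scoped Topology ENNReal

noncomputable section

namespace SparseTensorPCA

/-- The set `𝒳_{p,k}` of `k`-sparse binary vectors of length `p`, each one identified with its
support, a `k`-element subset of `{1, …, p}`. -/
abbrev SparseVec (p k : ℕ) : Type := {s : Finset (Fin p) // s.card = k}

/-- The `0/1` vector in `ℝ^p` with the given support. -/
def SparseVec.toVec {p k : ℕ} (x : SparseVec p k) : Fin p → ℝ :=
  fun i => if i ∈ x.1 then 1 else 0

/-- The Johnson graph `G_{p,k}`: `x` and `y` are adjacent iff `|x ∩ y| = k - 1`, that is, iff the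
two binary vectors differ in exactly two entries. -/
def johnsonGraph (p k : ℕ) : SimpleGraph (SparseVec p k) where
  Adj x y := (x.1 ∩ y.1).card + 1 = k
  symm := ⟨fun x y h => by rwa [Finset.inter_comm]⟩
  loopless := ⟨fun x h => by
    have h' : (x.1 ∩ x.1).card + 1 = k := h
    rw [Finset.inter_self, x.2] at h'
    omega⟩

/-- `t`-tensors of side `p` with real entries. -/
abbrev Tensor (p t : ℕ) : Type := (Fin t → Fin p) → ℝ

/-- The tensor power `u^{⊗ t}`. -/
def tensorPower {p : ℕ} (t : ℕ) (u : Fin p → ℝ) : Tensor p t :=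
  fun i => ∏ s, u (i s)

/-- The map `F(x / √k) = (x / √k)^{⊗ t}` on `𝒳_{p,k}`. -/
def feature {p k : ℕ} (t : ℕ) (x : SparseVec p k) : Tensor p t :=
  tensorPower t (fun j => x.toVec j / √(k : ℝ))

/-- The joint law of the signal `v` and the noise `W`: `v` is uniform on `𝒳_{p,k}`, the entries of
`W` are i.i.d. standard Gaussian variables, and `v` and `W` are independent. -/
def model (t p k : ℕ) : Measure (SparseVec p k × Tensor p t) :=
  (uniformOn (Set.univ : Set (SparseVec p k))).prod
    (Measure.pi fun _ : Fin t → Fin p => gaussianReal 0 1)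

/-- The observed tensor `Y = (lam / k^{t/2}) v^{⊗ t} + W`. -/
def observation {t p k : ℕ} (lam : ℝ) (ω : SparseVec p k × Tensor p t) : Tensor p t :=
  fun i => lam * feature t ω.1 i + ω.2 i

/-- The Hamiltonian `H(x) = ⟨(x / √k)^{⊗ t}, Y⟩`. -/
def hamiltonian {t p k : ℕ} (Y : Tensor p t) (x : SparseVec p k) : ℝ :=
  ∑ i, feature t x i * Y i

/-- The Gibbs measure `π_β(x) ∝ exp (β H(x))` on a finite set. -/
def gibbs {X : Type*} [Fintype X] (H : X → ℝ) (β : ℝ) (x : X) : ℝ :=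
  Real.exp (β * H x) / ∑ y, Real.exp (β * H y)

/-- `P` is the transition matrix of a (discrete time) Markov chain on the finite graph `G` which is
reversible with respect to `π`: in each step the chain either stays where it is or moves along an
edge of `G`, and the detailed balance equations hold. -/
structure IsReversibleChain {X : Type*} [Fintype X] (G : SimpleGraph X) (π : X → ℝ)
    (P : Matrix X X ℝ) : Prop where
  nonneg : ∀ x y, 0 ≤ P x y
  row_sum : ∀ x, ∑ y, P x y = 1
  moves_along_edges : ∀ x y, P x y ≠ 0 → x = y ∨ G.Adj x y
  detailed_balance : ∀ x y, π x * P x y = π y * P y x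

/-- The total variation distance between two probability vectors on a finite set. -/
def tvDist {X : Type*} [Fintype X] (μ ν : X → ℝ) : ℝ := (1 / 2) * ∑ x, |μ x - ν x|

/-- The mixing time: the least `n` such that `P^n(x, ·)` is within total variation distance `1/4`
of `π` for every starting state `x`; it is `⊤` if there is no such `n`. -/
def mixingTime {X : Type*} [Fintype X] [DecidableEq X] (P : Matrix X X ℝ) (π : X → ℝ) : ℕ∞ :=
  ⨅ n ∈ {n : ℕ | ∀ x, tvDist ((P ^ n) x) π ≤ 1 / 4}, (n : ℕ∞)

/-- The event that at every inverse temperature `β ≥ b`, every reversible Markov chain on the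
Johnson graph with stationary law `π_β` has mixing time at least `p ^ c`. -/
def slowMixing (t p k : ℕ) (lam b c : ℝ) : Set (SparseVec p k × Tensor p t) :=
  {ω | ∀ β : ℝ, b ≤ β → ∀ P : Matrix (SparseVec p k) (SparseVec p k) ℝ,
    IsReversibleChain (johnsonGraph p k) (gibbs (hamiltonian (observation lam ω)) β) P →
    ENNReal.ofReal ((p : ℝ) ^ c) ≤
      (mixingTime P (gibbs (hamiltonian (observation lam ω)) β) : ℝ≥0∞)}

end SparseTensorPCA

end

/-! Slow mixing comes from deep traps that the noise creates far from the signal. Suppose the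
Hamiltonian at `x` exceeds by `δ` its values on the sphere of overlap `l` around `x`. The ball of
overlap greater than `l` can only be left through that sphere, whose Gibbs mass is at most `N exp
(-βδ)` times that of `x`, with `N` bounding its size. Two traps with disjoint balls suffice, since
one ball has mass at most `1/2`; the bottleneck inequality then forces `exp (βδ) / (4N)` steps
(`le_mixingTime`).

Traps are found by planting. Take `k` disjoint blocks that avoid the support of `v`, and the vectors
choosing one coordinate in each block. Let `m` be slightly below the maximal order `√(2k log (p/k))`
of the noise field. The average over these vectors of the likelihood ratio for adding `m` times
their feature to the noise, truncated at `m + τ`, concentrates at `1` by a second moment computation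
(`sum_exp_agreement_le`). Hence, if a vector fails to be a trap with small probability when it is
planted, then with high probability not all vectors of the family fail in pure noise
(`stdGaussian_forall_bad_le`). Two families on disjoint blocks give the two traps. As these avoid
`v`, the signal can lower a barrier by at most `λ ((k - l)/k)^t`.

It remains to make the planted failure small. With `L = log (p/k)`, planting `x` gives the field at
overlap `l` the mean `m (l/k)^t`. For `t ≥ 3` and nearest neighbors, a union bound has exponent
about `tL/2` against `log (kp) = L + 2 log k`; the difference tends to infinity exactly when `k =
o(p^((t-2)/(t+2)))`. The barrier has order `1/√(kL)`, which suffices when `λ ≥ √k`, because then `b`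
is much larger than `L√(kL)`. For `t ≥ 3` and `λ ≤ √k`, the sphere of overlap `⌊k/2⌋` has a barrier
of order `√(kL)`, matching `b` much larger than `√(kL)`. For `t = 2` the nearest-neighbor union
bound is critical; treating the removed and the added coordinate separately gives a barrier of order
`√(L/k)` once `log k ≤ L/100`. -/

noncomputable section

namespace SparseTensorPCA

open Matrix

/-! ### Truncated likelihood ratios and the planting argument for Gaussian noise. -/

section Gaussian

variable {ι : Type*} [Fintype ι]

/-- The standard Gaussian measure on `ι → ℝ`. -/
abbrev stdGaussian (ι : Type*) [Fintype ι] : Measure (ι → ℝ) :=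
  Measure.pi fun _ : ι => gaussianReal 0 1

lemma measurable_dotProduct (a : ι → ℝ) : Measurable fun W : ι → ℝ => a ⬝ᵥ W := by
  unfold dotProduct
  fun_prop

lemma exp_dotProduct_add (a : ι → ℝ) (d : ℝ) (W : ι → ℝ) :
    Real.exp (a ⬝ᵥ W + d) = (∏ i, Real.exp (a i * W i)) * Real.exp d := by
  rw [Real.exp_add, dotProduct, Real.exp_sum]

lemma integrable_exp_dotProduct (a : ι → ℝ) (d : ℝ) :
    Integrable (fun W : ι → ℝ => Real.exp (a ⬝ᵥ W + d)) (stdGaussian ι) := by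
  simp only [exp_dotProduct_add]
  refine Integrable.mul_const ?_ _
  exact Integrable.fintype_prod (f := fun i (w : ℝ) => Real.exp (a i * w))
    fun i => integrable_exp_mul_gaussianReal (a i)

lemma integral_exp_dotProduct (a : ι → ℝ) (d : ℝ) :
    ∫ W : ι → ℝ, Real.exp (a ⬝ᵥ W + d) ∂stdGaussian ι = Real.exp ((a ⬝ᵥ a) / 2 + d) := by
  simp only [exp_dotProduct_add]
  rw [integral_mul_const, integral_fintype_prod_eq_prod (fun i (w : ℝ) => Real.exp (a i * w))]
  have h : ∀ i, ∫ w, Real.exp (a i * w) ∂gaussianReal 0 1 = Real.exp (a i * a i / 2) := by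
    intro i
    have := congrFun (mgf_fun_id_gaussianReal (μ := 0) (v := 1)) (a i)
    simp only [mgf] at this
    rw [this]
    congr 1
    simp
    ring
  simp only [h]
  rw [← Real.exp_sum, ← Real.exp_add, dotProduct, Finset.sum_div]

/-- The truncated likelihood ratio `exp (m z - m² / 2) 1{z ≤ m'}`. -/
def truncExp (m m' z : ℝ) : ℝ := if z ≤ m' then Real.exp (m * z - m ^ 2 / 2) else 0

lemma truncExp_nonneg (m m' z : ℝ) : 0 ≤ truncExp m m' z := by
  unfold truncExp
  split_ifs <;> positivity

lemma truncExp_le (m m' z : ℝ) : truncExp m m' z ≤ Real.exp (m * z - m ^ 2 / 2) := by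
  unfold truncExp
  split_ifs
  · exact le_rfl
  · positivity

lemma measurable_truncExp (m m' : ℝ) : Measurable (truncExp m m') := by
  unfold truncExp
  refine Measurable.ite measurableSet_Iic ?_ measurable_const
  fun_prop

/-- Chernoff bound for the discarded part: the indicator of `z > m + τ` is at most `exp (τ (z - m -
τ))`. -/
lemma le_truncExp {m τ : ℝ} (hτ : 0 ≤ τ) (z : ℝ) :
    Real.exp (m * z - m ^ 2 / 2) -
      Real.exp ((m + τ) * z + (-m ^ 2 / 2 - τ * (m + τ))) ≤ truncExp m (m + τ) z := by
  unfold truncExp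
  split_ifs with h
  · linarith [Real.exp_pos ((m + τ) * z + (-m ^ 2 / 2 - τ * (m + τ)))]
  · have : Real.exp (m * z - m ^ 2 / 2) ≤
        Real.exp ((m + τ) * z + (-m ^ 2 / 2 - τ * (m + τ))) := by
      apply Real.exp_le_exp.2
      nlinarith
    linarith

/-- On the truncation event one may lower the tilt: `m z ≤ s z + (m - s) m'`. The parameter `s` is
left free for optimization. -/
lemma truncExp_mul_le {m m' s : ℝ} (hs : s ≤ m) (z z' : ℝ) :
    truncExp m m' z * truncExp m m' z' ≤
      Real.exp (s * z + s * z' + (2 * (m - s) * m' - m ^ 2)) := by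
  unfold truncExp
  split_ifs with h h'
  · rw [← Real.exp_add]
    apply Real.exp_le_exp.2
    nlinarith
  all_goals simp; positivity

variable (φ ψ : ι → ℝ) (m τ : ℝ)

lemma measurable_truncExp_dotProduct (m' : ℝ) :
    Measurable fun W : ι → ℝ => truncExp m m' (φ ⬝ᵥ W) :=
  (measurable_truncExp m m').comp (measurable_dotProduct φ)

lemma integrable_truncExp (m' : ℝ) :
    Integrable (fun W => truncExp m m' (φ ⬝ᵥ W)) (stdGaussian ι) := by
  refine (integrable_exp_dotProduct (m • φ) (-m ^ 2 / 2)).mono'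
    (measurable_truncExp_dotProduct φ m m').aestronglyMeasurable ?_
  filter_upwards with W
  rw [Real.norm_of_nonneg (truncExp_nonneg _ _ _)]
  refine (truncExp_le _ _ _).trans_eq ?_
  rw [smul_dotProduct, smul_eq_mul]
  ring_nf

lemma integrable_truncExp_mul (m' : ℝ) :
    Integrable (fun W => truncExp m m' (φ ⬝ᵥ W) * truncExp m m' (ψ ⬝ᵥ W)) (stdGaussian ι) := by
  refine (integrable_exp_dotProduct (m • φ + m • ψ) (2 * (m - m) * m' - m ^ 2)).mono'
    ((measurable_truncExp_dotProduct φ m m').mul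
      (measurable_truncExp_dotProduct ψ m m')).aestronglyMeasurable ?_
  filter_upwards with W
  rw [Real.norm_of_nonneg (mul_nonneg (truncExp_nonneg _ _ _) (truncExp_nonneg _ _ _))]
  simpa only [add_dotProduct, smul_dotProduct, smul_eq_mul] using truncExp_mul_le le_rfl _ _

variable {φ ψ m τ}

lemma le_integral_truncExp (hφ : φ ⬝ᵥ φ = 1) (hτ : 0 ≤ τ) :
    1 - Real.exp (-τ ^ 2 / 2) ≤ ∫ W, truncExp m (m + τ) (φ ⬝ᵥ W) ∂stdGaussian ι := by
  have h1 : ∀ s d : ℝ, Integrable (fun W => Real.exp (s * (φ ⬝ᵥ W) + d)) (stdGaussian ι) := by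
    intro s d
    simpa only [smul_dotProduct, smul_eq_mul] using integrable_exp_dotProduct (s • φ) d
  have h2 : ∀ s d : ℝ, ∫ W, Real.exp (s * (φ ⬝ᵥ W) + d) ∂stdGaussian ι =
      Real.exp (s ^ 2 / 2 + d) := by
    intro s d
    have := integral_exp_dotProduct (s • φ) d
    simp only [smul_dotProduct, smul_eq_mul, dotProduct_smul, hφ] at this
    rw [this]
    ring_nf
  have h3 := integral_mono (μ := stdGaussian ι)
    ((h1 m (-m ^ 2 / 2)).sub (h1 (m + τ) (-m ^ 2 / 2 - τ * (m + τ))))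
    (integrable_truncExp φ m (m + τ)) (fun W => by
      have := le_truncExp (m := m) hτ (φ ⬝ᵥ W)
      simp only [Pi.sub_apply]
      refine le_trans (le_of_eq ?_) this
      ring_nf)
  simp only [Pi.sub_apply] at h3
  rw [integral_sub (h1 _ _) (h1 _ _), h2, h2] at h3
  refine le_trans (le_of_eq ?_) h3
  congr 1
  · rw [← Real.exp_zero]
    ring_nf
  · ring_nf

/-- Without truncation the exponent would be `m² c` with `c = φ ⬝ᵥ ψ`. Truncation improves `c` to `c
/ (1 + c)`, which halves the contribution of nearly equal points; this is what permits `m` close to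
the maximum of the field. -/
lemma integral_truncExp_mul_le (hφ : φ ⬝ᵥ φ = 1) (hψ : ψ ⬝ᵥ ψ = 1) (h0 : 0 ≤ φ ⬝ᵥ ψ)
    (hm : 0 ≤ m) (τ : ℝ) :
    ∫ W, truncExp m (m + τ) (φ ⬝ᵥ W) * truncExp m (m + τ) (ψ ⬝ᵥ W) ∂stdGaussian ι ≤
      Real.exp ((m + τ) ^ 2 * (φ ⬝ᵥ ψ / (1 + φ ⬝ᵥ ψ))) := by
  set c := φ ⬝ᵥ ψ with hc
  -- Under the tilt `s (φ + ψ)` both functionals have mean `s (1 + c)`; this choice makes that mean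
  -- `m`, and the exponent becomes `((m + τ)² - τ²) c / (1 + c)`.
  set s := m / (1 + c) with hs
  have hc1 : 0 < 1 + c := by linarith
  have hsm : s ≤ m := div_le_self hm (by linarith)
  have h := integral_mono (integrable_truncExp_mul φ ψ m (m + τ))
    (integrable_exp_dotProduct (s • φ + s • ψ) (2 * (m - s) * (m + τ) - m ^ 2)) (fun W => by
      simpa only [add_dotProduct, smul_dotProduct, smul_eq_mul] using truncExp_mul_le hsm _ _)
  refine h.trans ?_
  rw [integral_exp_dotProduct]
  apply Real.exp_le_exp.2
  have e1 : (s • φ + s • ψ) ⬝ᵥ (s • φ + s • ψ) = 2 * s ^ 2 * (1 + c) := by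
    simp only [add_dotProduct, dotProduct_add, smul_dotProduct, dotProduct_smul, smul_eq_mul,
      hφ, hψ, dotProduct_comm ψ φ, ← hc]
    ring
  rw [e1]
  have e2 : s * (1 + c) = m := by rw [hs]; field_simp
  have e3 : m - s = m * (c / (1 + c)) := by rw [hs]; field_simp; ring
  have e4 : 2 * s ^ 2 * (1 + c) / 2 = s * m := by rw [← e2]; ring
  have e5 : s = m - m * (c / (1 + c)) := by linarith
  rw [e4, e3, e5]
  have : 0 ≤ c / (1 + c) := by positivity
  nlinarith [sq_nonneg τ]

/-- If each `W ∈ Bad x` is detected by exponentials of linear functionals that are small under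
the planted measure at `x`, and the truncated likelihood ratio has second moment close to `1`,
then with high probability some `x` is not bad. -/
theorem stdGaussian_forall_bad_le {F κ : Type*} [Fintype F] [Nonempty F]
    {φ : F → ι → ℝ} (hunit : ∀ x, φ x ⬝ᵥ φ x = 1) (hpos : ∀ x y, 0 ≤ φ x ⬝ᵥ φ y)
    (hm : 0 ≤ m) (hτ : 0 ≤ τ) (J : F → Finset κ) (a : F → κ → ι → ℝ) (d : F → κ → ℝ)
    {ε₂ ε₃ : ℝ}
    (h2 : ∀ x, ∑ y, Real.exp ((m + τ) ^ 2 * (φ x ⬝ᵥ φ y / (1 + φ x ⬝ᵥ φ y))) ≤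
      Fintype.card F * (1 + ε₂))
    (h3 : ∀ x, ∑ j ∈ J x, Real.exp (((m • φ x + a x j) ⬝ᵥ (m • φ x + a x j)) / 2 +
      (-m ^ 2 / 2 + d x j)) ≤ ε₃)
    (Bad : F → Set (ι → ℝ))
    (hBad : ∀ x, ∀ W ∈ Bad x, 1 ≤ ∑ j ∈ J x, Real.exp (a x j ⬝ᵥ W + d x j)) :
    stdGaussian ι {W | ∀ x, W ∈ Bad x} ≤
      ENNReal.ofReal (4 * (ε₂ + 2 * Real.exp (-τ ^ 2 / 2)) + 2 * ε₃) := by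
  set N : ℝ := (Fintype.card F : ℝ) with hN
  have hN0 : 0 < N := by rw [hN]; exact_mod_cast Fintype.card_pos
  set w : F → (ι → ℝ) → ℝ := fun x W => truncExp m (m + τ) (φ x ⬝ᵥ W) with hw
  set X : (ι → ℝ) → ℝ := fun W => N⁻¹ * ∑ x, w x W with hX
  set Y : (ι → ℝ) → ℝ := fun W => N⁻¹ * ∑ x, ∑ j ∈ J x,
    Real.exp ((m • φ x + a x j) ⬝ᵥ W + (-m ^ 2 / 2 + d x j)) with hY
  have hwi : ∀ x, Integrable (w x) (stdGaussian ι) := fun x => integrable_truncExp _ _ _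
  have hwwi : ∀ x y, Integrable (fun W => w x W * w y W) (stdGaussian ι) :=
    fun x y => integrable_truncExp_mul _ _ _ _
  have hXi : Integrable X (stdGaussian ι) :=
    (integrable_finsetSum _ fun x _ => hwi x).const_mul _
  have hX2 : ∀ W, X W ^ 2 = N⁻¹ ^ 2 * ∑ x, ∑ y, w x W * w y W := by
    intro W
    simp only [hX]
    rw [mul_pow, sq (∑ x, w x W), Finset.sum_mul_sum]
  have hX2i : Integrable (fun W => X W ^ 2) (stdGaussian ι) := by
    simp only [hX2]
    exact (integrable_finsetSum _ fun x _ => integrable_finsetSum _ fun y _ => hwwi x y).const_mul _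
  have hYi : Integrable Y (stdGaussian ι) :=
    (integrable_finsetSum _ fun x _ => integrable_finsetSum _ fun j _ =>
      integrable_exp_dotProduct _ _).const_mul _
  have hEX : 1 - Real.exp (-τ ^ 2 / 2) ≤ ∫ W, X W ∂stdGaussian ι := by
    simp only [hX]
    rw [integral_const_mul, integral_finsetSum _ fun x _ => hwi x]
    have : ∑ _x : F, (1 - Real.exp (-τ ^ 2 / 2)) ≤ ∑ x, ∫ W, w x W ∂stdGaussian ι :=
      Finset.sum_le_sum fun x _ => le_integral_truncExp (hunit x) hτ
    rw [Finset.sum_const, nsmul_eq_mul, Finset.card_univ, ← hN] at this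
    rw [inv_mul_eq_div, le_div_iff₀ hN0]
    linarith
  have hEX2 : ∫ W, X W ^ 2 ∂stdGaussian ι ≤ 1 + ε₂ := by
    simp only [hX2]
    rw [integral_const_mul, integral_finsetSum _ fun x _ => integrable_finsetSum _ fun y _ => hwwi x y]
    have : ∑ x, ∫ W, ∑ y, w x W * w y W ∂stdGaussian ι ≤ ∑ _x : F, N * (1 + ε₂) := by
      refine Finset.sum_le_sum fun x _ => ?_
      rw [integral_finsetSum _ fun y _ => hwwi x y]
      refine le_trans (Finset.sum_le_sum fun y _ => ?_) (h2 x)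
      exact integral_truncExp_mul_le (hunit x) (hunit y) (hpos x y) hm τ
    rw [Finset.sum_const, nsmul_eq_mul, Finset.card_univ, ← hN] at this
    calc N⁻¹ ^ 2 * _ ≤ N⁻¹ ^ 2 * (N * (N * (1 + ε₂))) := by gcongr
      _ = 1 + ε₂ := by field_simp
  have hEY : ∫ W, Y W ∂stdGaussian ι ≤ ε₃ := by
    simp only [hY]
    rw [integral_const_mul, integral_finsetSum _ fun x _ => integrable_finsetSum _ fun j _ =>
      integrable_exp_dotProduct _ _]
    have : ∑ x, ∫ W, ∑ j ∈ J x, Real.exp ((m • φ x + a x j) ⬝ᵥ W + (-m ^ 2 / 2 + d x j))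
        ∂stdGaussian ι ≤ ∑ _x : F, ε₃ := by
      refine Finset.sum_le_sum fun x _ => ?_
      rw [integral_finsetSum _ fun j _ => integrable_exp_dotProduct _ _]
      simpa only [integral_exp_dotProduct] using h3 x
    rw [Finset.sum_const, nsmul_eq_mul, Finset.card_univ, ← hN] at this
    rw [inv_mul_eq_div, div_le_iff₀ hN0]
    linarith
  have hY0 : ∀ W, 0 ≤ Y W := fun W => mul_nonneg (inv_nonneg.2 hN0.le)
    (Finset.sum_nonneg fun x _ => Finset.sum_nonneg fun j _ => (Real.exp_pos _).le)
  -- If every point is bad then `X ≤ Y`. Either `X ≤ 1/2`, so that `4 (X - 1)² ≥ 1`, or `2Y ≥ 2X >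
  -- 1`; Markov's inequality for `g` covers both.
  set g : (ι → ℝ) → ℝ := fun W => 4 * (X W ^ 2 - 2 * X W + 1) + 2 * Y W with hg
  have hg0 : ∀ W, 0 ≤ g W := fun W => by
    simp only [hg]
    nlinarith [sq_nonneg (X W - 1), hY0 W]
  have i1 : Integrable (fun W => X W ^ 2 - 2 * X W) (stdGaussian ι) := hX2i.sub (hXi.const_mul 2)
  have i2 : Integrable (fun W => X W ^ 2 - 2 * X W + 1) (stdGaussian ι) :=
    i1.add (integrable_const 1)
  have hgi : Integrable g (stdGaussian ι) := (i2.const_mul 4).add (hYi.const_mul 2)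
  have hEg : ∫ W, g W ∂stdGaussian ι ≤ 4 * (ε₂ + 2 * Real.exp (-τ ^ 2 / 2)) + 2 * ε₃ := by
    have : ∫ W, g W ∂stdGaussian ι =
        4 * (∫ W, X W ^ 2 ∂stdGaussian ι - 2 * ∫ W, X W ∂stdGaussian ι + 1) +
          2 * ∫ W, Y W ∂stdGaussian ι := by
      simp only [hg]
      rw [integral_add (i2.const_mul 4) (hYi.const_mul 2), integral_const_mul, integral_const_mul,
        integral_add i1 (integrable_const 1), integral_sub hX2i (hXi.const_mul 2),
        integral_const_mul]
      simp
    rw [this]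
    linarith
  have hsub : {W | ∀ x, W ∈ Bad x} ⊆ {W | 1 ≤ ENNReal.ofReal (g W)} := by
    intro W hW
    have hXY : X W ≤ Y W := by
      simp only [hX, hY]
      refine mul_le_mul_of_nonneg_left (Finset.sum_le_sum fun x _ => ?_) (inv_nonneg.2 hN0.le)
      calc w x W ≤ Real.exp (m * (φ x ⬝ᵥ W) - m ^ 2 / 2) := truncExp_le _ _ _
        _ ≤ Real.exp (m * (φ x ⬝ᵥ W) - m ^ 2 / 2) *
            ∑ j ∈ J x, Real.exp (a x j ⬝ᵥ W + d x j) :=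
          le_mul_of_one_le_right (by positivity) (hBad x W (hW x))
        _ = _ := by
          rw [Finset.mul_sum]
          refine Finset.sum_congr rfl fun j _ => ?_
          rw [← Real.exp_add, add_dotProduct, smul_dotProduct, smul_eq_mul]
          ring_nf
    have : 1 ≤ g W := by
      simp only [hg]
      by_cases h : X W ≤ 1 / 2
      · nlinarith [hY0 W]
      · nlinarith [sq_nonneg (X W - 1)]
    simpa using this
  calc stdGaussian ι {W | ∀ x, W ∈ Bad x}
      ≤ stdGaussian ι {W | 1 ≤ ENNReal.ofReal (g W)} := measure_mono hsub
    _ ≤ (∫⁻ W, ENNReal.ofReal (g W) ∂stdGaussian ι) / 1 :=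
      meas_ge_le_lintegral_div hgi.1.aemeasurable.ennreal_ofReal one_ne_zero ENNReal.one_ne_top
    _ = ENNReal.ofReal (∫ W, g W ∂stdGaussian ι) := by
      rw [div_one, ofReal_integral_eq_lintegral_ofReal hgi (Eventually.of_forall hg0)]
    _ ≤ _ := ENNReal.ofReal_le_ofReal hEg

end Gaussian

/-! ### Inner products of tensor features and sphere sizes. -/

section Features

variable {p : ℕ}

/-- The tensor power of the indicator vector of `s`, scaled by `1 / √k`. -/
def featureOf (k t : ℕ) (s : Finset (Fin p)) : Tensor p t :=
  tensorPower t fun j => (if j ∈ s then 1 else 0) / √(k : ℝ)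

lemma feature_eq_featureOf {k : ℕ} (t : ℕ) (x : SparseVec p k) :
    feature t x = featureOf k t x.1 := rfl

lemma featureOf_dotProduct (k t : ℕ) (s s' : Finset (Fin p)) :
    featureOf k t s ⬝ᵥ featureOf k t s' = (((s ∩ s').card : ℝ) / k) ^ t := by
  have h : ∑ j : Fin p, ((if j ∈ s then 1 else 0) / √(k : ℝ)) *
      ((if j ∈ s' then 1 else 0) / √(k : ℝ)) = ((s ∩ s').card : ℝ) / k := by
    have : ∀ j : Fin p, ((if j ∈ s then 1 else 0) / √(k : ℝ)) *
        ((if j ∈ s' then 1 else 0) / √(k : ℝ)) = (if j ∈ s ∩ s' then 1 else 0) / (k : ℝ) := by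
      intro j
      rw [div_mul_div_comm, Real.mul_self_sqrt (Nat.cast_nonneg k)]
      by_cases h1 : j ∈ s <;> by_cases h2 : j ∈ s' <;> simp [h1, h2]
    simp only [this]
    rw [← Finset.sum_div, Finset.sum_boole, Finset.filter_mem_eq_inter, Finset.univ_inter]
  rw [← h, Fintype.sum_pow, dotProduct]
  refine Finset.sum_congr rfl fun i _ => ?_
  simp only [featureOf, tensorPower]
  rw [← Finset.prod_mul_distrib]

lemma hamiltonian_observation {t k : ℕ} (lam : ℝ) (ω : SparseVec p k × Tensor p t)
    (x : SparseVec p k) :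
    hamiltonian (observation lam ω) x =
      lam * (((x.1 ∩ ω.1.1).card : ℝ) / k) ^ t + featureOf k t x.1 ⬝ᵥ ω.2 := by
  rw [← featureOf_dotProduct]
  simp only [hamiltonian, observation, feature_eq_featureOf, dotProduct, mul_add,
    Finset.sum_add_distrib, Finset.mul_sum]
  congr 1
  exact Finset.sum_congr rfl fun i _ => by ring

/-- The number of `k`-sets meeting a given `k`-set in exactly `l` points. -/
lemma card_inter_eq_le {k : ℕ} (x : Finset (Fin p)) (hx : x.card = k) {l : ℕ} :
    (Finset.univ.filter fun y : SparseVec p k => (y.1 ∩ x).card = l).card ≤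
      k.choose l * p.choose (k - l) := by
  have : (x.powersetCard l ×ˢ (Finset.univ : Finset (Fin p)).powersetCard (k - l)).card =
      k.choose l * p.choose (k - l) := by
    rw [Finset.card_product, Finset.card_powersetCard, Finset.card_powersetCard, hx,
      Finset.card_univ, Fintype.card_fin]
  rw [← this]
  refine Finset.card_le_card_of_injOn (fun y => (y.1 ∩ x, y.1 \ x)) ?_ ?_
  · intro y hy
    have hy' : (y.1 ∩ x).card = l := by simpa using hy
    have h2 := Finset.card_inter_add_card_sdiff y.1 x
    rw [y.2, hy'] at h2
    simp only [Finset.coe_product, Set.mem_prod, Finset.mem_coe, Finset.mem_powersetCard]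
    refine ⟨⟨Finset.inter_subset_right, hy'⟩, Finset.subset_univ _, by omega⟩
  · intro y _ y' _ h
    simp only [Prod.mk.injEq] at h
    apply Subtype.ext
    rw [← Finset.sdiff_union_inter y.1 x, ← Finset.sdiff_union_inter y'.1 x, h.1, h.2]

end Features

/-! ### Transversals of disjoint blocks and the second moment of their likelihood ratios. -/

section Transversals

variable {p k q : ℕ}

/-- The number of coordinates at which two functions agree. -/
def agreement (g g' : Fin k → Fin q) : ℕ := (Finset.univ.filter fun i => g i = g' i).card

lemma agreement_le (g g' : Fin k → Fin q) : agreement g g' ≤ k :=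
  (Finset.card_filter_le _ _).trans (by simp)

/-- The `k`-set picking the element `g i` from the `i`-th of `k` disjoint blocks of size `q`. -/
def transversal (e : Fin k × Fin q ↪ Fin p) (g : Fin k → Fin q) : SparseVec p k :=
  ⟨Finset.univ.map ⟨fun i => e (i, g i), fun i j h => (Prod.ext_iff.1 (e.injective h)).1⟩,
    by simp⟩

lemma mem_transversal (e : Fin k × Fin q ↪ Fin p) (g : Fin k → Fin q) (j : Fin p) :
    j ∈ (transversal e g).1 ↔ ∃ i, e (i, g i) = j := by
  simp only [transversal, Finset.mem_map, Finset.mem_univ, true_and]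
  rfl

lemma transversal_inter_card (e : Fin k × Fin q ↪ Fin p) (g g' : Fin k → Fin q) :
    ((transversal e g).1 ∩ (transversal e g').1).card = agreement g g' := by
  rw [agreement, ← Finset.card_map
    ⟨fun i => e (i, g i), fun i j h => (Prod.ext_iff.1 (e.injective h)).1⟩]
  congr 1
  ext j
  simp only [Finset.mem_inter, mem_transversal, Finset.mem_map, Finset.mem_filter,
    Finset.mem_univ, true_and]
  constructor
  · rintro ⟨⟨i, hi⟩, i', hi'⟩
    have h := e.injective (hi.trans hi'.symm)
    simp only [Prod.mk.injEq] at h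
    obtain ⟨rfl, h⟩ := h
    exact ⟨i, h, hi⟩
  · rintro ⟨i, h, hi⟩
    exact ⟨⟨i, hi⟩, i, by rw [← h]; exact hi⟩

lemma card_agreement_eq_le (g : Fin k → Fin q) (l : ℕ) :
    (Finset.univ.filter fun g' => agreement g g' = l).card ≤ k.choose l * q ^ (k - l) := by
  classical
  have hsub : (Finset.univ.filter fun g' => agreement g g' = l) ⊆
      ((Finset.univ : Finset (Fin k)).powersetCard l).biUnion fun T =>
        Fintype.piFinset fun i => if i ∈ T then {g i} else Finset.univ := by
    intro g' hg'
    rw [Finset.mem_filter] at hg'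
    rw [Finset.mem_biUnion]
    refine ⟨Finset.univ.filter fun i => g i = g' i,
      Finset.mem_powersetCard.2 ⟨Finset.subset_univ _, hg'.2⟩, ?_⟩
    rw [Fintype.mem_piFinset]
    intro i
    by_cases h : g i = g' i <;> simp [h]
  refine (Finset.card_le_card hsub).trans ?_
  refine (Finset.card_biUnion_le_card_mul _ _ (q ^ (k - l)) ?_).trans_eq ?_
  · intro T hT
    rw [Finset.mem_powersetCard] at hT
    rw [Fintype.card_piFinset]
    have : ∀ i, (if i ∈ T then ({g i} : Finset (Fin q)) else Finset.univ).card =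
        if i ∈ T then 1 else q := by
      intro i
      split_ifs <;> simp
    simp only [this]
    rw [Finset.prod_ite]
    simp only [Finset.prod_const, one_pow, one_mul]
    rw [Finset.filter_not, Finset.card_sdiff_of_subset (Finset.filter_subset _ _)]
    simp [hT.2]
  · simp

lemma choose_mul_pow_le_exp {l : ℕ} (hl : 1 ≤ l) :
    (k.choose l : ℝ) ≤ ((k : ℝ) / l) ^ l * Real.exp l := by
  have h1 := Nat.choose_le_pow_div (α := ℝ) l k
  have h2 := Real.pow_div_factorial_le_exp (x := (l : ℝ)) (Nat.cast_nonneg l) l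
  have hl0 : (0 : ℝ) < l := by exact_mod_cast hl
  have hf : (0 : ℝ) < (l.factorial : ℝ) := by exact_mod_cast l.factorial_pos
  refine h1.trans ?_
  calc (k : ℝ) ^ l / l.factorial = ((k : ℝ) / l) ^ l * ((l : ℝ) ^ l / l.factorial) := by
        rw [div_pow]; field_simp
    _ ≤ _ := by gcongr

/-- The contribution of a large agreement `l` to the second moment. -/
lemma choose_mul_exp_le {t l : ℕ} (ht : 2 ≤ t) (hl : 1 ≤ l) (hlk : l ≤ k) {Λ M₂ : ℝ}
    (hΛ : 8 ≤ Λ) (hM : M₂ ≤ 2 * k * (Λ - 2 * 16 ^ t)) (hlΛ : k < l * Real.exp (Λ / 2)) :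
    (k.choose l : ℝ) * Real.exp (-(l * Λ)) *
      Real.exp (M₂ * (((l : ℝ) / k) ^ t / (1 + ((l : ℝ) / k) ^ t))) ≤
      Real.exp (-(l * Λ / 4)) + Real.exp (-k) := by
  have hl0 : (0 : ℝ) < l := by exact_mod_cast hl
  have hk0 : (0 : ℝ) < k := by exact_mod_cast (hl.trans hlk)
  set ρ : ℝ := (l : ℝ) / k with hρ
  have hρ0 : 0 < ρ := by positivity
  have hρ1 : ρ ≤ 1 := by rw [hρ, div_le_one hk0]; exact_mod_cast hlk
  have hkρ : k * ρ = l := by rw [hρ]; field_simp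
  have hct : ρ ^ t ≤ ρ ^ 2 := pow_le_pow_of_le_one hρ0.le hρ1 ht
  have hc0 : 0 < ρ ^ t := by positivity
  set c := ρ ^ t with hc
  set h := c / (1 + c) with hh
  have hh0 : 0 ≤ h := by positivity
  have hhc : h ≤ c := div_le_self hc0.le (by linarith)
  -- Equality holds at `ρ = 1`, where energy `2kΛh` and entropy `lΛ` balance exactly; the term `2 *
  -- 16 ^ t` subtracted from `Λ` supplies the slack there.
  have hhρ : 2 * h ≤ ρ := by
    rw [hh, ← mul_div_assoc, div_le_iff₀ (by positivity)]
    nlinarith [mul_nonneg hρ0.le (sq_nonneg (1 - ρ)), mul_nonneg (sub_nonneg.2 hct) (by linarith : 0 ≤ 2 - ρ)]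
  have hMh : M₂ * h ≤ 2 * k * (Λ - 2 * 16 ^ t) * h := by gcongr
  -- For `ρ ≤ 1/16` the energy is at most `lΛ/8` and the binomial at most `exp (l (Λ/2 + 1))`, so
  -- `exp (-lΛ)` wins as `Λ ≥ 8`. For larger `ρ`, `16 ^ t * ρ ^ t ≥ 1` turns the slack into `exp
  -- (-2k)`, which pays for a binomial of at most `exp k`.
  by_cases hmid : ρ ≤ 1 / 16
  · have h1 : M₂ * h ≤ l * Λ / 8 := by
      calc M₂ * h ≤ 2 * k * (Λ - 2 * 16 ^ t) * h := hMh
        _ ≤ 2 * k * Λ * h := by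
          have : (0 : ℝ) ≤ 2 * 16 ^ t := by positivity
          gcongr
          linarith
        _ ≤ 2 * k * Λ * (ρ * (1 / 16)) := by
          gcongr
          nlinarith
        _ = l * Λ / 8 := by rw [← hkρ]; ring
    have h2 : (k.choose l : ℝ) ≤ Real.exp (l * (Λ / 2) + l) := by
      refine (choose_mul_pow_le_exp hl).trans ?_
      rw [Real.exp_add, Real.exp_nat_mul]
      gcongr
      rw [div_le_iff₀ hl0, mul_comm]
      exact hlΛ.le
    calc _ ≤ Real.exp (l * (Λ / 2) + l) * Real.exp (-(l * Λ)) * Real.exp (l * Λ / 8) := by gcongr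
      _ = Real.exp (l * (Λ / 2) + l + -(l * Λ) + l * Λ / 8) := by rw [← Real.exp_add, ← Real.exp_add]
      _ ≤ Real.exp (-(l * Λ / 4)) := by
        apply Real.exp_le_exp.2
        nlinarith
      _ ≤ _ := by linarith [Real.exp_pos (-(k : ℝ))]
  · push Not at hmid
    have h16 : 1 ≤ 16 ^ t * c := by
      rw [hc, ← mul_pow]
      exact one_le_pow₀ (by linarith)
    have hhc2 : c ≤ 2 * h := by
      have hc1 : c ≤ 1 := pow_le_one₀ hρ0.le hρ1
      rw [hh, ← mul_div_assoc, le_div_iff₀ (by positivity)]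
      nlinarith
    have h1 : M₂ * h ≤ l * Λ - 2 * k := by
      calc M₂ * h ≤ 2 * k * (Λ - 2 * 16 ^ t) * h := hMh
        _ = k * Λ * (2 * h) - 2 * k * (16 ^ t * (2 * h)) := by ring
        _ ≤ k * Λ * ρ - 2 * k * 1 := by
          have : 1 ≤ 16 ^ t * (2 * h) := h16.trans (by gcongr)
          gcongr
        _ = l * Λ - 2 * k := by rw [← hkρ]; ring
    have h2 : (k.choose l : ℝ) ≤ Real.exp k := by
      have e1 : (k.choose l : ℝ) ≤ 2 ^ k := by exact_mod_cast Nat.choose_le_two_pow k l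
      refine e1.trans ?_
      rw [← mul_one (k : ℝ), Real.exp_nat_mul]
      gcongr
      linarith [Real.add_one_le_exp 1]
    calc _ ≤ Real.exp k * Real.exp (-(l * Λ)) * Real.exp (l * Λ - 2 * k) := by gcongr
      _ = Real.exp (-k) := by rw [← Real.exp_add, ← Real.exp_add]; ring_nf
      _ ≤ _ := by linarith [Real.exp_pos (-(l * Λ / 4))]

lemma sum_exp_neg_mul_le {a : ℝ} (ha : 1 ≤ a) (k : ℕ) :
    ∑ l ∈ Finset.Icc 1 k, Real.exp (-(l * a)) ≤ 2 * Real.exp (-a) := by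
  have h1 : Real.exp (-a) ≤ 1 / 2 := by
    rw [Real.exp_neg, one_div]
    apply inv_anti₀ (by norm_num)
    linarith [Real.add_one_le_exp a]
  have h2 : ∀ k : ℕ, ∑ l ∈ Finset.Icc 1 k, Real.exp (-(l * a)) ≤
      2 * Real.exp (-a) - 2 * Real.exp (-((k + 1 : ℕ) * a)) := by
    intro k
    induction k with
    | zero => simp
    | succ n ih =>
      rw [Finset.sum_Icc_succ_top (by omega)]
      have : Real.exp (-((n + 1 + 1 : ℕ) * a)) =
          Real.exp (-((n + 1 : ℕ) * a)) * Real.exp (-a) := by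
        rw [← Real.exp_add]
        push_cast
        ring_nf
      rw [this]
      nlinarith [Real.exp_pos (-((n + 1 : ℕ) * a))]
  linarith [h2 k, Real.exp_pos (-((k + 1 : ℕ) * a))]

/-- Agreements `l ≤ k exp (-Λ/2)`, with `Λ = log q`, are typical and contribute a factor close to
`1`; here `k ≤ exp (tΛ/4)` keeps `kΛ (l/k)^t` small. Larger agreements are rare enough to beat their
weight by `choose_mul_exp_le`. -/
theorem sum_exp_agreement_le {t : ℕ} (ht : 2 ≤ t) (hk : 1 ≤ k) (hq : 8 ≤ Real.log q)
    (hkq : (k : ℝ) ≤ Real.exp (t * Real.log q / 4)) {M₂ : ℝ}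
    (hM : M₂ ≤ 2 * k * (Real.log q - 2 * 16 ^ t)) (g : Fin k → Fin q) :
    ∑ g' : Fin k → Fin q, Real.exp (M₂ * (((agreement g g' : ℝ) / k) ^ t /
        (1 + ((agreement g g' : ℝ) / k) ^ t))) ≤
      (q : ℝ) ^ k * (Real.exp (2 * Real.log q * Real.exp (-(Real.log q / 2))) +
        (2 * Real.exp (-(Real.log q / 4)) + k * Real.exp (-k))) := by
  set Λ := Real.log q with hΛ
  have hq0 : (0 : ℝ) < q := by
    rcases Nat.eq_zero_or_pos q with h | h
    · rw [hΛ, h] at hq; norm_num at hq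
    · exact_mod_cast h
  have hk0 : (0 : ℝ) < k := by exact_mod_cast hk
  have ht' : (2 : ℝ) ≤ t := by exact_mod_cast ht
  set f : ℕ → ℝ := fun l => Real.exp (M₂ * (((l : ℝ) / k) ^ t / (1 + ((l : ℝ) / k) ^ t))) with hf
  set E₁ := Real.exp (2 * Λ * Real.exp (-(Λ / 2))) with hE₁
  have hsmall : ∀ l : ℕ, l * Real.exp (Λ / 2) ≤ k → f l ≤ E₁ := by
    intro l hl
    apply Real.exp_le_exp.2
    have hρ : (l : ℝ) / k ≤ Real.exp (-(Λ / 2)) := by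
      rw [Real.exp_neg, div_le_iff₀ hk0, inv_mul_eq_div, le_div_iff₀ (Real.exp_pos _)]
      exact hl
    have hc0 : 0 ≤ ((l : ℝ) / k) ^ t := by positivity
    have hc : ((l : ℝ) / k) ^ t ≤ Real.exp (-(t * Λ / 2)) := by
      calc ((l : ℝ) / k) ^ t ≤ Real.exp (-(Λ / 2)) ^ t := by gcongr
        _ = _ := by rw [← Real.exp_nat_mul]; ring_nf
    calc M₂ * (((l : ℝ) / k) ^ t / (1 + ((l : ℝ) / k) ^ t))
        ≤ 2 * k * (Λ - 2 * 16 ^ t) * (((l : ℝ) / k) ^ t / (1 + ((l : ℝ) / k) ^ t)) := by gcongr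
      _ ≤ 2 * k * Λ * (((l : ℝ) / k) ^ t / (1 + ((l : ℝ) / k) ^ t)) := by
        have : (0 : ℝ) ≤ 2 * 16 ^ t := by positivity
        gcongr
        linarith
      _ ≤ 2 * k * Λ * Real.exp (-(t * Λ / 2)) := by
        gcongr
        exact (div_le_self hc0 (by linarith)).trans hc
      _ ≤ 2 * Real.exp (t * Λ / 4) * Λ * Real.exp (-(t * Λ / 2)) := by gcongr
      _ = 2 * Λ * Real.exp (-(t * Λ / 4)) := by
        have : Real.exp (-(t * Λ / 4)) = Real.exp (t * Λ / 4) * Real.exp (-(t * Λ / 2)) := by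
          rw [← Real.exp_add]; ring_nf
        rw [this]; ring
      _ ≤ 2 * Λ * Real.exp (-(Λ / 2)) := by
        refine mul_le_mul_of_nonneg_left (Real.exp_le_exp.2 ?_) (by linarith)
        nlinarith
  -- Small agreements are bounded pointwise and never counted; only the large ones are grouped by
  -- level.
  have hpt : ∀ g' : Fin k → Fin q, f (agreement g g') ≤ E₁ +
      ∑ l ∈ Finset.Icc 1 k, if agreement g g' = l then
        (if (k : ℝ) < l * Real.exp (Λ / 2) then f l else 0) else 0 := by
    intro g'
    have hnn : ∀ l ∈ Finset.Icc 1 k, 0 ≤ if agreement g g' = l then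
        (if (k : ℝ) < l * Real.exp (Λ / 2) then f l else 0) else 0 := by
      intro l _
      split_ifs <;> first | exact le_rfl | exact (Real.exp_pos _).le
    by_cases h : (k : ℝ) < agreement g g' * Real.exp (Λ / 2)
    · have h1 : 1 ≤ agreement g g' := by
        by_contra h0
        have : agreement g g' = 0 := by omega
        rw [this] at h
        simp at h
        linarith
      have := Finset.single_le_sum hnn (Finset.mem_Icc.2 ⟨h1, agreement_le g g'⟩)
      rw [if_pos rfl, if_pos h] at this
      linarith [Real.exp_pos (2 * Λ * Real.exp (-(Λ / 2)))]
    · linarith [hsmall _ (not_lt.1 h), Finset.sum_nonneg hnn]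
  refine (Finset.sum_le_sum fun g' _ => hpt g').trans ?_
  rw [Finset.sum_add_distrib, Finset.sum_comm, mul_add]
  refine add_le_add ?_ ?_
  · simp
  have hterm : ∀ l ∈ Finset.Icc 1 k, (∑ g' : Fin k → Fin q, if agreement g g' = l then
        (if (k : ℝ) < l * Real.exp (Λ / 2) then f l else 0) else 0) ≤
      (q : ℝ) ^ k * (Real.exp (-(l * (Λ / 4))) + Real.exp (-k)) := by
    intro l hl
    rw [Finset.mem_Icc] at hl
    rw [← Finset.sum_filter, Finset.sum_const, nsmul_eq_mul]
    split_ifs with h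
    · have hcard : ((Finset.univ.filter fun g' => agreement g g' = l).card : ℝ) ≤
          k.choose l * ((q : ℝ) ^ k * Real.exp (-(l * Λ))) := by
        have h1 : ((Finset.univ.filter fun g' => agreement g g' = l).card : ℝ) ≤
          k.choose l * (q : ℝ) ^ (k - l) := by exact_mod_cast card_agreement_eq_le g l
        refine h1.trans_eq ?_
        rw [Real.exp_neg, Real.exp_nat_mul, hΛ, Real.exp_log hq0, pow_sub₀ _ hq0.ne' hl.2]
      calc _ ≤ k.choose l * ((q : ℝ) ^ k * Real.exp (-(l * Λ))) * f l :=
            mul_le_mul_of_nonneg_right hcard (Real.exp_pos _).le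
        _ = (q : ℝ) ^ k * (k.choose l * Real.exp (-(l * Λ)) * f l) := by ring
        _ ≤ (q : ℝ) ^ k * (Real.exp (-(l * Λ / 4)) + Real.exp (-k)) := by
          gcongr
          exact choose_mul_exp_le ht hl.1 hl.2 hq hM h
        _ = _ := by ring_nf
    · rw [mul_zero]; positivity
  refine (Finset.sum_le_sum hterm).trans ?_
  rw [← Finset.mul_sum, Finset.sum_add_distrib]
  gcongr
  · exact sum_exp_neg_mul_le (by linarith) k
  · simp

end Transversals

/-! ### Conductance bounds for reversible chains. -/

section Bottleneck

variable {X : Type*} [Fintype X]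

lemma sum_sub_sum_le_tvDist {μ ν : X → ℝ} (hμ : ∑ x, μ x = 1) (hν : ∑ x, ν x = 1)
    (S : Finset X) : ∑ x ∈ S, ν x - ∑ x ∈ S, μ x ≤ tvDist μ ν := by
  classical
  have h1 : ∑ x ∈ S, (ν x - μ x) ≤ ∑ x ∈ S, |μ x - ν x| :=
    Finset.sum_le_sum fun x _ => by rw [abs_sub_comm]; exact le_abs_self _
  have h2 : ∑ x ∈ Sᶜ, (μ x - ν x) ≤ ∑ x ∈ Sᶜ, |μ x - ν x| :=
    Finset.sum_le_sum fun x _ => le_abs_self _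
  have h3 := Finset.sum_add_sum_compl S fun x => |μ x - ν x|
  have h4 := Finset.sum_add_sum_compl S μ
  have h5 := Finset.sum_add_sum_compl S ν
  rw [Finset.sum_sub_distrib] at h1 h2
  unfold tvDist
  linarith

variable [DecidableEq X] {G : SimpleGraph X} {π : X → ℝ} {P : Matrix X X ℝ}

lemma IsReversibleChain.pow_nonneg (hP : IsReversibleChain G π P) (n : ℕ) (x y : X) :
    0 ≤ (P ^ n) x y := by
  induction n generalizing x y with
  | zero =>
    rw [pow_zero, Matrix.one_apply]
    split_ifs <;> norm_num
  | succ n ih =>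
    rw [pow_succ, Matrix.mul_apply]
    exact Finset.sum_nonneg fun z _ => mul_nonneg (ih x z) (hP.nonneg z y)

lemma IsReversibleChain.pow_row_sum (hP : IsReversibleChain G π P) (n : ℕ) (x : X) :
    ∑ y, (P ^ n) x y = 1 := by
  induction n with
  | zero => simp [Matrix.one_apply]
  | succ n ih =>
    simp only [pow_succ, Matrix.mul_apply]
    rw [Finset.sum_comm]
    simp only [← Finset.mul_sum, hP.row_sum, mul_one, ih]

lemma IsReversibleChain.pow_stationary (hP : IsReversibleChain G π P) (n : ℕ) (y : X) :
    ∑ x, π x * (P ^ n) x y = π y := by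
  induction n generalizing y with
  | zero => simp [Matrix.one_apply]
  | succ n ih =>
    simp only [pow_succ, Matrix.mul_apply, Finset.mul_sum]
    rw [Finset.sum_comm]
    have : ∀ z, ∑ x, π x * ((P ^ n) x z * P z y) = π y * P y z := by
      intro z
      rw [← hP.detailed_balance z y, ← ih z, Finset.sum_mul]
      exact Finset.sum_congr rfl fun x _ => by ring
    simp only [this]
    rw [← Finset.mul_sum, hP.row_sum, mul_one]

/-- Starting from `π` restricted to `A`, the mass outside `A` after `n` steps is at most `n π(B)`
if the chain can only leave `A` through `B`. -/
lemma IsReversibleChain.escape_le (hP : IsReversibleChain G π P) (hπ : ∀ x, 0 ≤ π x)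
    {A B : Finset X} (hAB : ∀ y ∈ A, ∀ z ∉ A, G.Adj y z → z ∈ B) (n : ℕ) :
    ∑ x ∈ A, π x * ∑ z ∈ Aᶜ, (P ^ n) x z ≤ n * ∑ z ∈ B, π z := by
  -- By detailed balance the flow from `A` into `z` equals the flow from `z` into `A`, which is at
  -- most `π z`.
  have hflow : ∑ y ∈ A, π y * ∑ z ∈ Aᶜ, P y z ≤ ∑ z ∈ B, π z := by
    simp only [Finset.mul_sum]
    rw [Finset.sum_comm]
    calc ∑ z ∈ Aᶜ, ∑ y ∈ A, π y * P y z ≤ ∑ z ∈ Aᶜ, if z ∈ B then π z else 0 := by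
          refine Finset.sum_le_sum fun z hz => ?_
          rw [Finset.mem_compl] at hz
          split_ifs with hzB
          · calc ∑ y ∈ A, π y * P y z = π z * ∑ y ∈ A, P z y := by
                  rw [Finset.mul_sum]
                  exact Finset.sum_congr rfl fun y _ => hP.detailed_balance y z
              _ ≤ π z * 1 := by
                  refine mul_le_mul_of_nonneg_left ?_ (hπ z)
                  rw [← hP.row_sum z]
                  exact Finset.sum_le_sum_of_subset_of_nonneg (Finset.subset_univ _)
                    fun y _ _ => hP.nonneg z y
              _ = π z := mul_one _
          · refine (Finset.sum_eq_zero fun y hy => ?_).le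
            have : P y z = 0 := by
              by_contra h
              rcases hP.moves_along_edges y z h with h | h
              · exact hz (h ▸ hy)
              · exact hzB (hAB y hy z hz h)
            rw [this, mul_zero]
      _ ≤ ∑ z, if z ∈ B then π z else 0 :=
          Finset.sum_le_sum_of_subset_of_nonneg (Finset.subset_univ _) fun z _ _ => by
            split_ifs
            exacts [hπ z, le_rfl]
      _ = ∑ z ∈ B, π z := by simp
  induction n with
  | zero =>
    refine (Finset.sum_eq_zero fun x hx => ?_).le.trans (by simp)
    have : ∑ z ∈ Aᶜ, (P ^ 0) x z = 0 := Finset.sum_eq_zero fun z hz => by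
      rw [pow_zero, Matrix.one_apply, if_neg]
      rintro rfl
      exact (Finset.mem_compl.1 hz) hx
    rw [this, mul_zero]
  | succ n ih =>
    have hsplit : ∀ x, ∑ z ∈ Aᶜ, (P ^ (n + 1)) x z ≤
        ∑ y ∈ A, (P ^ n) x y * ∑ z ∈ Aᶜ, P y z + ∑ y ∈ Aᶜ, (P ^ n) x y := by
      intro x
      simp only [pow_succ, Matrix.mul_apply]
      rw [Finset.sum_comm, ← Finset.sum_add_sum_compl A]
      simp only [← Finset.mul_sum]
      gcongr with y hy
      refine mul_le_of_le_one_right (hP.pow_nonneg n x y) ?_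
      rw [← hP.row_sum y]
      exact Finset.sum_le_sum_of_subset_of_nonneg (Finset.subset_univ _)
        fun z _ _ => hP.nonneg y z
    have h1 : ∑ x ∈ A, π x * ∑ y ∈ A, (P ^ n) x y * ∑ z ∈ Aᶜ, P y z ≤ ∑ z ∈ B, π z := by
      refine le_trans ?_ hflow
      simp only [Finset.mul_sum (s := A)]
      rw [Finset.sum_comm]
      refine Finset.sum_le_sum fun y _ => ?_
      have h2 : ∑ x ∈ A, π x * (P ^ n) x y ≤ π y := by
        rw [← hP.pow_stationary n y]
        exact Finset.sum_le_sum_of_subset_of_nonneg (Finset.subset_univ _)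
          fun x _ _ => mul_nonneg (hπ x) (hP.pow_nonneg n x y)
      calc _ = (∑ x ∈ A, π x * (P ^ n) x y) * ∑ z ∈ Aᶜ, P y z := by
            rw [Finset.sum_mul]
            exact Finset.sum_congr rfl fun x _ => by ring
        _ ≤ _ := mul_le_mul_of_nonneg_right h2 (Finset.sum_nonneg fun z _ => hP.nonneg y z)
    calc _ ≤ ∑ x ∈ A, π x * (∑ y ∈ A, (P ^ n) x y * ∑ z ∈ Aᶜ, P y z +
            ∑ y ∈ Aᶜ, (P ^ n) x y) :=
          Finset.sum_le_sum fun x _ => mul_le_mul_of_nonneg_left (hsplit x) (hπ x)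
      _ ≤ _ := by
          simp only [mul_add, Finset.sum_add_distrib]
          push_cast
          linarith

/-- A bottleneck bound for the mixing time. -/
theorem IsReversibleChain.bottleneck (hP : IsReversibleChain G π P) (hπ : ∀ x, 0 ≤ π x)
    (hπ1 : ∑ x, π x = 1) {A B : Finset X} (hAB : ∀ y ∈ A, ∀ z ∉ A, G.Adj y z → z ∈ B)
    (hA : ∑ x ∈ A, π x ≤ 1 / 2) {n : ℕ} (hn : ∀ x, tvDist ((P ^ n) x) π ≤ 1 / 4) :
    ∑ x ∈ A, π x ≤ 4 * n * ∑ z ∈ B, π z := by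
  have h := hP.escape_le hπ hAB n
  have h1 : ∑ x ∈ A, π x * (1 / 4) ≤ ∑ x ∈ A, π x * ∑ z ∈ Aᶜ, (P ^ n) x z := by
    refine Finset.sum_le_sum fun x _ => mul_le_mul_of_nonneg_left ?_ (hπ x)
    have h2 := sum_sub_sum_le_tvDist (hP.pow_row_sum n x) hπ1 Aᶜ
    have h3 := Finset.sum_add_sum_compl A π
    linarith [hn x]
  rw [← Finset.sum_mul] at h1
  linarith

end Bottleneck

/-! ### Elementary properties of Gibbs weights. -/

section Gibbs

variable {X : Type*} [Fintype X]

lemma gibbs_nonneg (H : X → ℝ) (β : ℝ) (x : X) : 0 ≤ gibbs H β x :=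
  div_nonneg (Real.exp_pos _).le (Finset.sum_nonneg fun _ _ => (Real.exp_pos _).le)

lemma sum_exp_pos [Nonempty X] (H : X → ℝ) (β : ℝ) : 0 < ∑ y, Real.exp (β * H y) :=
  Finset.sum_pos (fun _ _ => Real.exp_pos _) Finset.univ_nonempty

lemma sum_gibbs [Nonempty X] (H : X → ℝ) (β : ℝ) : ∑ x, gibbs H β x = 1 := by
  unfold gibbs
  rw [← Finset.sum_div, div_self (sum_exp_pos H β).ne']

lemma gibbs_le_of_le [Nonempty X] {H : X → ℝ} {β δ : ℝ} (hβ : 0 ≤ β) {x y : X}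
    (h : H y ≤ H x - δ) :
    gibbs H β y ≤ gibbs H β x * Real.exp (-(β * δ)) := by
  unfold gibbs
  rw [div_mul_eq_mul_div, ← Real.exp_add]
  refine div_le_div_of_nonneg_right (Real.exp_le_exp.2 ?_) (sum_exp_pos H β).le
  nlinarith

end Gibbs

/-! ### From two disjoint traps to slow mixing on the Johnson graph. -/

section Johnson

variable {p k : ℕ}

/-- An edge of the Johnson graph removes only one element, so the overlap drops by at most one and
cannot jump over the value `l`. -/
lemma le_inter_card_of_adj {l : ℕ} {x y z : SparseVec p k} (hy : l < (y.1 ∩ x.1).card)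
    (hz : ¬ l < (z.1 ∩ x.1).card) (h : (johnsonGraph p k).Adj y z) : (z.1 ∩ x.1).card = l := by
  have h' : (y.1 ∩ z.1).card + 1 = k := h
  have h1 := Finset.card_inter_add_card_sdiff y.1 z.1
  rw [y.2] at h1
  have h2 : y.1 ∩ x.1 ⊆ (z.1 ∩ x.1) ∪ (y.1 \ z.1) := by
    intro j hj
    simp only [Finset.mem_inter, Finset.mem_union, Finset.mem_sdiff] at hj ⊢
    tauto
  have h3 := (Finset.card_le_card h2).trans (Finset.card_union_le _ _)
  omega

/-- If the Hamiltonian is smaller by `δ` on the spheres around two points with disjoint supports,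
then every reversible chain mixes slowly. -/
theorem le_mixingTime {H : SparseVec p k → ℝ} {x₁ x₂ : SparseVec p k}
    (hd : Disjoint x₁.1 x₂.1) {l N : ℕ} (hl : l < k) (hl2 : k < 2 * (l + 1)) {δ : ℝ}
    (h₁ : ∀ y : SparseVec p k, (y.1 ∩ x₁.1).card = l → H y ≤ H x₁ - δ)
    (h₂ : ∀ y : SparseVec p k, (y.1 ∩ x₂.1).card = l → H y ≤ H x₂ - δ)
    (hN : ∀ x : SparseVec p k,
      (Finset.univ.filter fun y : SparseVec p k => (y.1 ∩ x.1).card = l).card ≤ N)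
    {β r : ℝ} (hβ : 0 ≤ β) (hr : 4 * N * r ≤ Real.exp (β * δ))
    {P : Matrix (SparseVec p k) (SparseVec p k) ℝ}
    (hP : IsReversibleChain (johnsonGraph p k) (gibbs H β) P) :
    ENNReal.ofReal r ≤ (mixingTime P (gibbs H β) : ℝ≥0∞) := by
  have : Nonempty (SparseVec p k) := ⟨x₁⟩
  have key : ∀ n : ℕ, (∀ x, tvDist ((P ^ n) x) (gibbs H β) ≤ 1 / 4) → r ≤ n := by
    intro n hn
    have main : ∀ x : SparseVec p k,
        (∀ y : SparseVec p k, (y.1 ∩ x.1).card = l → H y ≤ H x - δ) →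
        ∑ y ∈ Finset.univ.filter (fun y : SparseVec p k => l < (y.1 ∩ x.1).card),
          gibbs H β y ≤ 1 / 2 → r ≤ n := by
      intro x hx hA
      have hb := hP.bottleneck (gibbs_nonneg H β) (sum_gibbs H β)
        (A := Finset.univ.filter fun y : SparseVec p k => l < (y.1 ∩ x.1).card)
        (B := Finset.univ.filter fun y : SparseVec p k => (y.1 ∩ x.1).card = l)
        (fun y hy z hz h => by
          simp only [Finset.mem_filter, Finset.mem_univ, true_and] at hy hz ⊢
          exact le_inter_card_of_adj hy hz h) hA hn
      have hxA : gibbs H β x ≤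
          ∑ y ∈ Finset.univ.filter (fun y : SparseVec p k => l < (y.1 ∩ x.1).card),
            gibbs H β y :=
        Finset.single_le_sum (fun y _ => gibbs_nonneg H β y) (by
          simp only [Finset.mem_filter, Finset.mem_univ, true_and]
          rw [Finset.inter_self, x.2]
          exact hl)
      have hB : ∑ y ∈ Finset.univ.filter (fun y : SparseVec p k => (y.1 ∩ x.1).card = l),
          gibbs H β y ≤ N * (gibbs H β x * Real.exp (-(β * δ))) := by
        refine (Finset.sum_le_card_nsmul _ _ (gibbs H β x * Real.exp (-(β * δ))) ?_).trans ?_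
        · intro y hy
          exact gibbs_le_of_le hβ (hx y (Finset.mem_filter.1 hy).2)
        · rw [nsmul_eq_mul]
          have := gibbs_nonneg H β x
          gcongr
          exact hN x
      have hpos : 0 < gibbs H β x := div_pos (Real.exp_pos _) (sum_exp_pos H β)
      have h1 : gibbs H β x ≤ gibbs H β x * (4 * n * N * Real.exp (-(β * δ))) :=
        calc gibbs H β x ≤ 4 * n * (N * (gibbs H β x * Real.exp (-(β * δ)))) :=
              hxA.trans (hb.trans (by gcongr))
          _ = _ := by ring
      have h2 : 1 ≤ 4 * n * N * Real.exp (-(β * δ)) := le_of_mul_le_mul_left (by linarith) hpos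
      rw [Real.exp_neg, ← div_eq_mul_inv, le_div_iff₀ (Real.exp_pos _), one_mul] at h2
      have h3 : (4 * N : ℝ) * r ≤ 4 * N * n := hr.trans (h2.trans_eq (by ring))
      rcases Nat.eq_zero_or_pos N with h0 | h0
      · rw [h0] at h2
        simp at h2
        linarith [Real.exp_pos (β * δ)]
      · exact le_of_mul_le_mul_left h3 (by positivity)
    set A₁ := Finset.univ.filter fun y : SparseVec p k => l < (y.1 ∩ x₁.1).card with hA₁
    set A₂ := Finset.univ.filter fun y : SparseVec p k => l < (y.1 ∩ x₂.1).card with hA₂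
    -- A common point would meet each of two disjoint sets in at least `l + 1` elements, while `2 (l
    -- + 1) > k`.
    have hdA : Disjoint A₁ A₂ := by
      rw [Finset.disjoint_left]
      intro y hy1 hy2
      simp only [hA₁, hA₂, Finset.mem_filter, Finset.mem_univ, true_and] at hy1 hy2
      have h1 : Disjoint (y.1 ∩ x₁.1) (y.1 ∩ x₂.1) :=
        hd.mono Finset.inter_subset_right Finset.inter_subset_right
      have h2 := Finset.card_union_of_disjoint h1
      have h3 : ((y.1 ∩ x₁.1) ∪ (y.1 ∩ x₂.1)).card ≤ y.1.card :=
        Finset.card_le_card (Finset.union_subset Finset.inter_subset_left Finset.inter_subset_left)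
      rw [y.2] at h3
      omega
    have hsum : ∑ y ∈ A₁, gibbs H β y + ∑ y ∈ A₂, gibbs H β y ≤ 1 := by
      rw [← Finset.sum_union hdA, ← sum_gibbs H β]
      exact Finset.sum_le_sum_of_subset_of_nonneg (Finset.subset_univ _)
        fun y _ _ => gibbs_nonneg H β y
    by_cases hcase : ∑ y ∈ A₁, gibbs H β y ≤ 1 / 2
    · exact main x₁ h₁ hcase
    · exact main x₂ h₂ (by linarith)
  have h1 : ((⌈r⌉₊ : ℕ) : ℕ∞) ≤ mixingTime P (gibbs H β) := by
    refine le_iInf₂ fun n hn => ?_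
    exact_mod_cast Nat.ceil_le.2 (key n hn)
  calc ENNReal.ofReal r ≤ ENNReal.ofReal (⌈r⌉₊ : ℕ) :=
        ENNReal.ofReal_le_ofReal (Nat.le_ceil r)
    _ = (((⌈r⌉₊ : ℕ) : ℕ∞) : ℝ≥0∞) := by simp
    _ ≤ _ := by exact_mod_cast h1

end Johnson

/-! ### Planted failure probabilities for the three kinds of barrier. -/

section BadEvents

variable {p k q t l : ℕ}

/-- The noise tensors for which the noise field at some point of the sphere around `x` exceeds
the one at `x` up to `δ`. -/
def sphereBad (t l : ℕ) (δ : ℝ) (x : SparseVec p k) : Set (Tensor p t) :=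
  {W | ∃ y : SparseVec p k, (y.1 ∩ x.1).card = l ∧
    featureOf k t x.1 ⬝ᵥ W - δ < featureOf k t y.1 ⬝ᵥ W}

/-- The sphere of points with overlap `l` with `x`. -/
def sphere (l : ℕ) (x : SparseVec p k) : Finset (SparseVec p k) :=
  Finset.univ.filter fun y => (y.1 ∩ x.1).card = l

lemma mem_sphere {x y : SparseVec p k} : y ∈ sphere l x ↔ (y.1 ∩ x.1).card = l := by
  simp [sphere]

/-- Bound for the failure probability coming from the second moment of the truncated likelihood
ratio. -/
def momentError (k q : ℕ) (τ : ℝ) : ℝ :=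
  4 * ((Real.exp (2 * Real.log q * Real.exp (-(Real.log q / 2))) +
    (2 * Real.exp (-(Real.log q / 4)) + k * Real.exp (-k)) - 1) + 2 * Real.exp (-τ ^ 2 / 2))

lemma featureOf_self (hk : 1 ≤ k) (t : ℕ) (x : SparseVec p k) :
    featureOf k t x.1 ⬝ᵥ featureOf k t x.1 = 1 := by
  have : (0 : ℝ) < k := by exact_mod_cast hk
  rw [featureOf_dotProduct, Finset.inter_self, x.2, div_self this.ne', one_pow]

/-- The planting argument specialized to transversals: the second moment is settled here once, so
each kind of barrier only has to supply its Chernoff tests. -/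
theorem forall_transversal_bad_le {κ : Type*} (ht : 2 ≤ t) (hk : 1 ≤ k) (hq : 8 ≤ Real.log q)
    (hkq : (k : ℝ) ≤ Real.exp (t * Real.log q / 4)) {m τ : ℝ} (hm : 0 ≤ m) (hτ : 0 ≤ τ)
    (hM : (m + τ) ^ 2 ≤ 2 * k * (Real.log q - 2 * 16 ^ t)) (e : Fin k × Fin q ↪ Fin p)
    (J : SparseVec p k → Finset κ) (a : SparseVec p k → κ → Tensor p t)
    (d : SparseVec p k → κ → ℝ) {ε₃ : ℝ}
    (h3 : ∀ x, ∑ j ∈ J x, Real.exp (((m • featureOf k t x.1 + a x j) ⬝ᵥ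
      (m • featureOf k t x.1 + a x j)) / 2 + (-m ^ 2 / 2 + d x j)) ≤ ε₃)
    (Bad : SparseVec p k → Set (Tensor p t))
    (hBad : ∀ x, ∀ W ∈ Bad x, 1 ≤ ∑ j ∈ J x, Real.exp (a x j ⬝ᵥ W + d x j)) :
    stdGaussian (Fin t → Fin p) {W | ∀ g, W ∈ Bad (transversal e g)} ≤
      ENNReal.ofReal (momentError k q τ + 2 * ε₃) := by
  have hq0 : 0 < q := by
    rcases Nat.eq_zero_or_pos q with h | h
    · rw [h] at hq; norm_num at hq
    · exact h
  have : Nonempty (Fin k → Fin q) := ⟨fun _ => ⟨0, hq0⟩⟩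
  refine stdGaussian_forall_bad_le (φ := fun g => featureOf k t (transversal e g).1)
    (fun g => featureOf_self hk t _) (fun g g' => ?_) hm hτ (fun g => J (transversal e g))
    (fun g => a (transversal e g)) (fun g => d (transversal e g)) (fun g => ?_)
    (fun g => h3 _) (fun g => Bad (transversal e g)) (fun g => hBad _)
  · rw [featureOf_dotProduct]; positivity
  · simp only [featureOf_dotProduct, transversal_inter_card]
    refine (sum_exp_agreement_le ht hk hq hkq hM g).trans_eq ?_
    rw [Fintype.card_fun, Fintype.card_fin, Fintype.card_fin]
    push_cast
    ring

lemma one_le_exp_sum {κ : Type*} {s : Finset κ} {f : κ → ℝ} {j : κ} (hj : j ∈ s)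
    (h : 0 ≤ f j) : 1 ≤ ∑ j ∈ s, Real.exp (f j) :=
  (Real.one_le_exp h).trans
    (Finset.single_le_sum (f := fun j => Real.exp (f j)) (fun _ _ => (Real.exp_pos _).le) hj)

variable (ht : 2 ≤ t) (hk : 1 ≤ k) (hq : 8 ≤ Real.log q)
    (hkq : (k : ℝ) ≤ Real.exp (t * Real.log q / 4)) {m τ : ℝ} (hm : 0 ≤ m) (hτ : 0 ≤ τ)
    (hM : (m + τ) ^ 2 ≤ 2 * k * (Real.log q - 2 * 16 ^ t)) (e : Fin k × Fin q ↪ Fin p)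
    {N : ℕ} (hN : ∀ x : SparseVec p k, (sphere l x).card ≤ N)

include ht hk hq hkq hm hτ hM hN

/-- A direct union bound over the sphere. -/
theorem sphereBad_le_of_union_bound (δ : ℝ) :
    stdGaussian (Fin t → Fin p) {W | ∀ g, W ∈ sphereBad t l δ (transversal e g)} ≤
      ENNReal.ofReal (momentError k q τ +
        2 * (N * Real.exp (-(m ^ 2 / 4 * (1 - ((l : ℝ) / k) ^ t)) + m * δ / 2))) := by
  refine forall_transversal_bad_le ht hk hq hkq hm hτ hM e (sphere l)
    -- With `x` planted and `c = (l/k)^t`, the difference of the fields has mean `-m (1 - c)` and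
    -- variance `2 (1 - c)`, so `m / 2` is the optimal Chernoff tilt for exceeding `0`.
    (fun x y => (m / 2) • (featureOf k t y.1 - featureOf k t x.1)) (fun _ _ => m * δ / 2)
    (fun x => ?_) _ (fun x W hW => ?_)
  · have hterm : ∀ y ∈ sphere l x, Real.exp (((m • featureOf k t x.1 +
        (m / 2) • (featureOf k t y.1 - featureOf k t x.1)) ⬝ᵥ (m • featureOf k t x.1 +
        (m / 2) • (featureOf k t y.1 - featureOf k t x.1))) / 2 +
          (-m ^ 2 / 2 + m * δ / 2)) =
        Real.exp (-(m ^ 2 / 4 * (1 - ((l : ℝ) / k) ^ t)) + m * δ / 2) := by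
      intro y hy
      rw [mem_sphere] at hy
      congr 1
      simp only [add_dotProduct, dotProduct_add, smul_dotProduct, dotProduct_smul, smul_eq_mul,
        sub_dotProduct, dotProduct_sub, featureOf_self hk]
      simp only [featureOf_dotProduct, Finset.inter_comm x.1 y.1, hy]
      ring
    rw [Finset.sum_congr rfl hterm, Finset.sum_const, nsmul_eq_mul]
    gcongr
    exact hN x
  · obtain ⟨y, hy, h⟩ := hW
    refine one_le_exp_sum (mem_sphere.2 hy) ?_
    rw [smul_dotProduct, sub_dotProduct, smul_eq_mul]
    nlinarith

/-- A union bound over the sphere after conditioning on the field at the center being large. -/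
theorem sphereBad_le_of_center (δ σ : ℝ) (hσ : 0 ≤ m - σ - δ - m * ((l : ℝ) / k) ^ t) (hσ0 : 0 ≤ σ) :
    stdGaussian (Fin t → Fin p) {W | ∀ g, W ∈ sphereBad t l δ (transversal e g)} ≤
      ENNReal.ofReal (momentError k q τ +
        2 * (Real.exp (-σ ^ 2 / 2) +
          N * Real.exp (-(m - σ - δ - m * ((l : ℝ) / k) ^ t) ^ 2 / 2))) := by
  set s := m - σ - δ - m * ((l : ℝ) / k) ^ t with hs
  refine forall_transversal_bad_le ht hk hq hkq hm hτ hM e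
    (fun x => Finset.insertNone (sphere l x))
    -- The test `none` detects a center below `m - σ`; the test `y` detects a field above `m - σ -
    -- δ`, which is `s` above its planted mean.
    (fun x o => o.elim ((-σ) • featureOf k t x.1) fun y => s • featureOf k t y.1)
    (fun _ o => o.elim (σ * (m - σ)) fun _ => -(s * (m - σ - δ))) (fun x => ?_) _
    (fun x W hW => ?_)
  · rw [Finset.sum_insertNone]
    have hterm : ∀ y ∈ sphere l x, Real.exp (((m • featureOf k t x.1 +
        s • featureOf k t y.1) ⬝ᵥ (m • featureOf k t x.1 + s • featureOf k t y.1)) / 2 +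
          (-m ^ 2 / 2 + -(s * (m - σ - δ)))) = Real.exp (-s ^ 2 / 2) := by
      intro y hy
      rw [mem_sphere] at hy
      congr 1
      simp only [add_dotProduct, dotProduct_add, smul_dotProduct, dotProduct_smul, smul_eq_mul,
        featureOf_self hk]
      simp only [featureOf_dotProduct, Finset.inter_comm x.1 y.1, hy]
      have : m - σ - δ = s + m * ((l : ℝ) / k) ^ t := by rw [hs]; ring
      rw [this]
      ring
    simp only [Option.elim]
    rw [Finset.sum_congr rfl hterm, Finset.sum_const, nsmul_eq_mul]
    refine add_le_add (le_of_eq ?_) ?_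
    · congr 1
      simp only [add_dotProduct, dotProduct_add, smul_dotProduct, dotProduct_smul, smul_eq_mul,
        featureOf_self hk]
      ring
    · gcongr
      exact hN x
  · obtain ⟨y, hy, h⟩ := hW
    by_cases hc : featureOf k t x.1 ⬝ᵥ W ≤ m - σ
    · refine one_le_exp_sum (j := none) (Finset.none_mem_insertNone) ?_
      simp only [Option.elim, smul_dotProduct, smul_eq_mul]
      nlinarith
    · refine one_le_exp_sum (j := some y) (Finset.some_mem_insertNone.2 (mem_sphere.2 hy)) ?_
      simp only [Option.elim, smul_dotProduct, smul_eq_mul]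
      push Not at hc
      nlinarith

/-- A union bound over the removed and the added element of a neighbor separately. -/
theorem sphereBad_le_of_split (hl : l + 1 = k) {θ₁ θ₂ : ℝ} (ht0 : 0 < 1 - ((l : ℝ) / k) ^ t)
    (hθ₁ : 0 ≤ m * (1 - ((l : ℝ) / k) ^ t) - θ₁) (hθ₂ : 0 ≤ θ₂) :
    stdGaussian (Fin t → Fin p) {W | ∀ g, W ∈ sphereBad t l (θ₁ - θ₂) (transversal e g)} ≤
      ENNReal.ofReal (momentError k q τ + 2 *
        (k * Real.exp (-((m * (1 - ((l : ℝ) / k) ^ t) - θ₁) ^ 2 /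
            (2 * (1 - ((l : ℝ) / k) ^ t)))) +
          N * Real.exp (-(θ₂ ^ 2 / (2 * (1 - ((l : ℝ) / k) ^ t)))))) := by
  set c := ((l : ℝ) / k) ^ t with hc
  set s₁ := (m * (1 - c) - θ₁) / (1 - c) with hs₁
  set s₂ := θ₂ / (1 - c) with hs₂
  have hs₁0 : 0 ≤ s₁ := by positivity
  have hs₂0 : 0 ≤ s₂ := by positivity
  refine forall_transversal_bad_le ht hk hq hkq hm hτ hM e
    (fun x => x.1.disjSum (sphere l x))
    -- A move is split at `y ∩ x`. Removal has mean `-m (1 - c)` but only `k` choices; addition has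
    -- up to `N` choices but planted mean `0`. Each increment has variance `1 - c`.
    (fun x j => j.elim (fun i => s₁ • (featureOf k t (x.1.erase i) - featureOf k t x.1))
      fun y => s₂ • (featureOf k t y.1 - featureOf k t (y.1 ∩ x.1)))
    (fun _ j => j.elim (fun _ => s₁ * θ₁) fun _ => -(s₂ * θ₂)) (fun x => ?_) _
    (fun x W hW => ?_)
  · rw [Finset.sum_disjSum]
    simp only [Sum.elim_inl, Sum.elim_inr]
    have hterm1 : ∀ i ∈ x.1, Real.exp (((m • featureOf k t x.1 +
        s₁ • (featureOf k t (x.1.erase i) - featureOf k t x.1)) ⬝ᵥ (m • featureOf k t x.1 +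
        s₁ • (featureOf k t (x.1.erase i) - featureOf k t x.1))) / 2 +
          (-m ^ 2 / 2 + s₁ * θ₁)) = Real.exp (-((m * (1 - c) - θ₁) ^ 2 / (2 * (1 - c)))) := by
      intro i hi
      have hcard : (x.1.erase i).card = l := by rw [Finset.card_erase_of_mem hi, x.2]; omega
      congr 1
      simp only [add_dotProduct, dotProduct_add, smul_dotProduct, dotProduct_smul, smul_eq_mul,
        sub_dotProduct, dotProduct_sub, featureOf_self hk]
      simp only [featureOf_dotProduct, Finset.inter_self,
        Finset.inter_eq_left.2 (Finset.erase_subset i x.1),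
        Finset.inter_eq_right.2 (Finset.erase_subset i x.1), hcard, ← hc]
      rw [hs₁]
      field_simp
      ring
    have hterm2 : ∀ y ∈ sphere l x, Real.exp (((m • featureOf k t x.1 +
        s₂ • (featureOf k t y.1 - featureOf k t (y.1 ∩ x.1))) ⬝ᵥ (m • featureOf k t x.1 +
        s₂ • (featureOf k t y.1 - featureOf k t (y.1 ∩ x.1)))) / 2 +
          (-m ^ 2 / 2 + -(s₂ * θ₂))) = Real.exp (-(θ₂ ^ 2 / (2 * (1 - c)))) := by
      intro y hy
      rw [mem_sphere] at hy
      congr 1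
      simp only [add_dotProduct, dotProduct_add, smul_dotProduct, dotProduct_smul, smul_eq_mul,
        sub_dotProduct, dotProduct_sub, featureOf_self hk]
      simp only [featureOf_dotProduct, Finset.inter_self, Finset.inter_comm x.1 y.1,
        Finset.inter_eq_left.2 (Finset.inter_subset_left (s₁ := y.1) (s₂ := x.1)),
        Finset.inter_eq_right.2 (Finset.inter_subset_left (s₁ := y.1) (s₂ := x.1)),
        Finset.inter_eq_left.2 (Finset.inter_subset_right (s₁ := y.1) (s₂ := x.1)),
        Finset.inter_eq_right.2 (Finset.inter_subset_right (s₁ := y.1) (s₂ := x.1)), hy, ← hc]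
      rw [hs₂]
      field_simp
      ring
    rw [Finset.sum_congr rfl hterm1, Finset.sum_congr rfl hterm2, Finset.sum_const,
      Finset.sum_const, nsmul_eq_mul, nsmul_eq_mul, x.2]
    gcongr
    exact hN x
  · obtain ⟨y, hy, h⟩ := hW
    by_cases hcase : θ₂ ≤ featureOf k t y.1 ⬝ᵥ W - featureOf k t (y.1 ∩ x.1) ⬝ᵥ W
    · refine one_le_exp_sum (j := Sum.inr y) (Finset.inr_mem_disjSum.2 (mem_sphere.2 hy)) ?_
      simp only [Sum.elim_inr, smul_dotProduct, sub_dotProduct, smul_eq_mul]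
      nlinarith
    · push Not at hcase
      have h1 := Finset.card_sdiff_add_card_inter x.1 y.1
      rw [x.2, Finset.inter_comm, hy] at h1
      obtain ⟨i, hi⟩ := Finset.card_eq_one.1 (show (x.1 \ y.1).card = 1 by omega)
      have hix : i ∈ x.1 := by
        have : i ∈ x.1 \ y.1 := by rw [hi]; exact Finset.mem_singleton_self i
        exact (Finset.mem_sdiff.1 this).1
      have hinter : y.1 ∩ x.1 = x.1.erase i := by
        rw [Finset.erase_eq, ← hi, Finset.sdiff_sdiff_self_left, Finset.inter_comm]
      refine one_le_exp_sum (j := Sum.inl i) (Finset.inl_mem_disjSum.2 hix) ?_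
      simp only [Sum.elim_inl, smul_dotProduct, sub_dotProduct, smul_eq_mul]
      rw [hinter] at hcase
      nlinarith

end BadEvents

/-! ### Adding the signal: two families of blocks that avoid `v`. -/

section Model

variable {p k q t l : ℕ}

lemma exists_disjoint_blocks (v : Finset (Fin p)) (hv : v.card = k) (h : 2 * (k * q) + k ≤ p) :
    ∃ e₁ e₂ : Fin k × Fin q ↪ Fin p, (∀ a, e₁ a ∉ v) ∧ (∀ a, e₂ a ∉ v) ∧
      ∀ a b, e₁ a ≠ e₂ b := by
  have hcard : Fintype.card (Bool × (Fin k × Fin q)) ≤ Fintype.card {j : Fin p // j ∉ v} := by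
    rw [Fintype.card_subtype_compl, Fintype.card_coe, hv]
    simp only [Fintype.card_prod, Fintype.card_bool, Fintype.card_fin]
    omega
  obtain ⟨f⟩ := Function.Embedding.nonempty_of_card_le hcard
  refine ⟨⟨fun a => (f (false, a)).1, fun a b h => ?_⟩,
    ⟨fun a => (f (true, a)).1, fun a b h => ?_⟩,
    fun a => (f (false, a)).2, fun a => (f (true, a)).2, fun a b h => ?_⟩
  · have := f.injective (Subtype.ext h)
    simpa using this
  · have := f.injective (Subtype.ext h)
    simpa using this
  · have := f.injective (Subtype.ext h)
    simp at this

/-- The signal vanishes at `x`, and `y` can meet the support of `v` only in its `k - l` elements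
outside `x`. -/
lemma hamiltonian_le_of_notMem_sphereBad {lam δ : ℝ} (hlam : 0 ≤ lam)
    {ω : SparseVec p k × Tensor p t} {x y : SparseVec p k} (ht : t ≠ 0)
    (hx : Disjoint x.1 ω.1.1) (hω : ω.2 ∉ sphereBad t l δ x) (hy : (y.1 ∩ x.1).card = l) :
    hamiltonian (observation lam ω) y ≤ hamiltonian (observation lam ω) x -
      (δ - lam * (((k - l : ℕ) : ℝ) / k) ^ t) := by
  have h1 : featureOf k t y.1 ⬝ᵥ ω.2 ≤ featureOf k t x.1 ⬝ᵥ ω.2 - δ := by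
    by_contra h
    exact hω ⟨y, hy, not_le.1 h⟩
  have h2 : (y.1 ∩ ω.1.1).card ≤ k - l := by
    have h3 := Finset.card_sdiff_add_card_inter y.1 x.1
    rw [y.2, hy] at h3
    have h4 : y.1 ∩ ω.1.1 ⊆ y.1 \ x.1 := by
      intro j hj
      rw [Finset.mem_inter] at hj
      exact Finset.mem_sdiff.2 ⟨hj.1, fun h => Finset.disjoint_left.1 hx h hj.2⟩
    have := Finset.card_le_card h4
    omega
  rw [hamiltonian_observation, hamiltonian_observation, Finset.disjoint_iff_inter_eq_empty.1 hx]
  have h3 : lam * (((y.1 ∩ ω.1.1).card : ℝ) / k) ^ t ≤ lam * (((k - l : ℕ) : ℝ) / k) ^ t := by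
    gcongr
  simp only [Finset.card_empty, Nat.cast_zero, zero_div, zero_pow ht, mul_zero]
  linarith

/-- Slow mixing holds with high probability as soon as, with high probability, each family of
transversals contains a point which is not bad. -/
theorem model_slowMixing_compl_le {lam b c δ : ℝ} {N : ℕ} {ε : ℝ≥0∞} (ht : t ≠ 0) (hl : l < k)
    (hl2 : k < 2 * (l + 1)) (hpq : 2 * (k * q) + k ≤ p)
    (hN : ∀ x : SparseVec p k, (sphere l x).card ≤ N) (hlam : 0 ≤ lam) (hb : 0 ≤ b)
    (hδ : 0 ≤ δ - lam * (((k - l : ℕ) : ℝ) / k) ^ t)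
    (hc : 4 * N * (p : ℝ) ^ c ≤ Real.exp (b * (δ - lam * (((k - l : ℕ) : ℝ) / k) ^ t)))
    (hε : ∀ e : Fin k × Fin q ↪ Fin p, stdGaussian (Fin t → Fin p)
      {W | ∀ g, W ∈ sphereBad t l δ (transversal e g)} ≤ ε) :
    model t p k (slowMixing t p k lam b c)ᶜ ≤ 2 * ε := by
  -- The blocks depend on `v` alone, so for each fixed `v` the pure-noise bound applies by
  -- independence.
  choose e₁ e₂ he₁ he₂ he using fun v : SparseVec p k =>
    exists_disjoint_blocks (q := q) v.1 v.2 hpq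
  set E : SparseVec p k → Set (Tensor p t) := fun v =>
    {W | ∀ g, W ∈ sphereBad t l δ (transversal (e₁ v) g)} ∪
      {W | ∀ g, W ∈ sphereBad t l δ (transversal (e₂ v) g)} with hE
  have hsub : (slowMixing t p k lam b c)ᶜ ⊆
      ⋃ v ∈ (Finset.univ : Finset (SparseVec p k)), {v} ×ˢ E v := by
    rintro ω hω
    simp only [Finset.mem_univ, Set.iUnion_true, Set.mem_iUnion, Set.mem_prod,
      Set.mem_singleton_iff]
    refine ⟨ω.1, rfl, ?_⟩
    by_contra hnot
    apply hω
    simp only [hE, Set.mem_union, Set.mem_ofPred_eq, not_or, not_forall] at hnot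
    obtain ⟨⟨g₁, hg₁⟩, g₂, hg₂⟩ := hnot
    intro β hβ P hP
    have hd1 : Disjoint (transversal (e₁ ω.1) g₁).1 ω.1.1 := by
      rw [Finset.disjoint_left]
      intro j hj
      obtain ⟨i, rfl⟩ := (mem_transversal _ _ _).1 hj
      exact he₁ _ _
    have hd2 : Disjoint (transversal (e₂ ω.1) g₂).1 ω.1.1 := by
      rw [Finset.disjoint_left]
      intro j hj
      obtain ⟨i, rfl⟩ := (mem_transversal _ _ _).1 hj
      exact he₂ _ _
    have hd : Disjoint (transversal (e₁ ω.1) g₁).1 (transversal (e₂ ω.1) g₂).1 := by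
      rw [Finset.disjoint_left]
      intro j hj hj'
      obtain ⟨i, rfl⟩ := (mem_transversal _ _ _).1 hj
      obtain ⟨i', hi'⟩ := (mem_transversal _ _ _).1 hj'
      exact he _ _ _ hi'.symm
    have H1 := fun y hy => hamiltonian_le_of_notMem_sphereBad (y := y) hlam ht hd1 hg₁ hy
    have H2 := fun y hy => hamiltonian_le_of_notMem_sphereBad (y := y) hlam ht hd2 hg₂ hy
    have hexp : 4 * N * (p : ℝ) ^ c ≤
        Real.exp (β * (δ - lam * (((k - l : ℕ) : ℝ) / k) ^ t)) :=
      hc.trans (Real.exp_le_exp.2 (mul_le_mul_of_nonneg_right hβ hδ))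
    exact le_mixingTime hd hl hl2 H1 H2 hN (hb.trans hβ) hexp hP
  have hE2 : ∀ v, stdGaussian (Fin t → Fin p) (E v) ≤ 2 * ε := fun v =>
    (measure_union_le _ _).trans ((add_le_add (hε _) (hε _)).trans_eq (two_mul ε).symm)
  calc model t p k (slowMixing t p k lam b c)ᶜ
      ≤ model t p k (⋃ v ∈ (Finset.univ : Finset (SparseVec p k)), {v} ×ˢ E v) :=
        measure_mono hsub
    _ ≤ ∑ v : SparseVec p k, model t p k ({v} ×ˢ E v) := measure_biUnion_finset_le _ _
    _ = ∑ v : SparseVec p k, uniformOn (Set.univ : Set (SparseVec p k)) {v} *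
          stdGaussian (Fin t → Fin p) (E v) :=
        Finset.sum_congr rfl fun v _ => Measure.prod_prod _ _
    _ ≤ ∑ v : SparseVec p k, uniformOn (Set.univ : Set (SparseVec p k)) {v} * (2 * ε) := by
        gcongr with v
        exact hE2 v
    _ = uniformOn (Set.univ : Set (SparseVec p k)) Set.univ * (2 * ε) := by
        rw [← Finset.sum_mul, sum_measure_singleton, Finset.coe_univ]
    _ ≤ 1 * (2 * ε) := by
        gcongr
        rw [uniformOn_univ, Measure.count_apply MeasurableSet.univ]
        simp [ENNReal.div_self_le_one]
    _ = 2 * ε := one_mul _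

end Model

/-! ### Choice of scales and explicit failure bounds. -/

section Scales

/-- The loss in the exponent of the planted strength compared to the ground state. -/
def loss (t : ℕ) : ℝ := 3 + 2 * 16 ^ t

/-- The planted strength: slightly below the typical maximum of the noise field. -/
def strength (t k : ℕ) (L : ℝ) : ℝ := √(2 * k * (L - loss t)) - √√(k : ℝ)

lemma loss_pos (t : ℕ) : 5 ≤ loss t := by
  have : (1 : ℝ) ≤ 16 ^ t := one_le_pow₀ (by norm_num)
  unfold loss
  linarith

variable {p k t : ℕ} {L : ℝ}

lemma cast_eq_mul_exp (hk : 1 ≤ k) (hp : 1 ≤ p) (hL : L = Real.log ((p : ℝ) / k)) :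
    (p : ℝ) = k * Real.exp L := by
  have h1 : (0 : ℝ) < k := by exact_mod_cast hk
  have h2 : (0 : ℝ) < p := by exact_mod_cast hp
  rw [hL, Real.exp_log (by positivity)]
  field_simp

lemma blocks_fit (hk : 1 ≤ k) (hp : 1 ≤ p) (hL : L = Real.log ((p : ℝ) / k)) (h1 : 1 ≤ L) :
    2 * (k * (p / (4 * k))) + k ≤ p := by
  have h2 : 4 * k * (p / (4 * k)) ≤ p := Nat.mul_div_le p (4 * k)
  have h3 : (2 * k : ℝ) ≤ p := by
    rw [cast_eq_mul_exp hk hp hL, mul_comm]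
    gcongr
    linarith [Real.add_one_le_exp L]
  have h4 : 2 * k ≤ p := by exact_mod_cast h3
  have h5 : 4 * k * (p / (4 * k)) = 4 * (k * (p / (4 * k))) := by ring
  omega

lemma le_log_block (hk : 1 ≤ k) (hp : 1 ≤ p) (hL : L = Real.log ((p : ℝ) / k)) (h1 : 7 ≤ L) :
    L - 3 ≤ Real.log ((p / (4 * k) : ℕ) : ℝ) := by
  have hk0 : (0 : ℝ) < k := by exact_mod_cast hk
  have hpk := cast_eq_mul_exp hk hp hL
  have h2 : (p : ℝ) / (4 * k) < ((p / (4 * k) : ℕ) : ℝ) + 1 := by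
    have := Nat.lt_floor_add_one ((p : ℝ) / ((4 * k : ℕ) : ℝ))
    rw [Nat.floor_div_natCast, Nat.floor_natCast] at this
    push_cast at this
    exact this
  have h3 : (p : ℝ) / (4 * k) = Real.exp L / 4 := by
    rw [hpk]
    field_simp
  have h4 : (8 : ℝ) ≤ Real.exp L := by linarith [Real.add_one_le_exp L]
  have h5 : Real.exp (L - 3) ≤ Real.exp L / 8 := by
    rw [Real.exp_sub]
    gcongr
    have : Real.exp 3 = Real.exp 1 ^ 3 := by rw [← Real.exp_nat_mul]; norm_num
    rw [this]
    have : (2 : ℝ) ≤ Real.exp 1 := by linarith [Real.add_one_le_exp 1]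
    calc (8 : ℝ) = 2 ^ 3 := by norm_num
      _ ≤ _ := by gcongr
  rw [Real.le_log_iff_exp_le (by linarith)]
  linarith

/-- The constants bracket `√2`: the loss and the shift `√√k` cost at most a few percent at these
scales. -/
lemma strength_bounds (hx : 100 ≤ √√(k : ℝ)) (hLt : 100 * loss t ≤ L) :
    1.38 * √(k * L) ≤ strength t k L ∧ strength t k L ≤ 1.415 * √(k * L) := by
  have hl := loss_pos t
  set x := √√(k : ℝ) with hxdef
  have hx2 : x ^ 2 = √(k : ℝ) := Real.sq_sqrt (Real.sqrt_nonneg _)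
  have hk0 : (0 : ℝ) ≤ k := Nat.cast_nonneg k
  unfold strength
  rw [← hxdef]
  constructor
  · have h1 : 1.40 * √(k * L) ≤ √(2 * k * (L - loss t)) := by
      apply Real.le_sqrt_of_sq_le
      rw [mul_pow, Real.sq_sqrt (mul_nonneg hk0 (by linarith))]
      nlinarith
    have h2 : x ^ 2 ≤ √(k * L) := by
      rw [hx2]
      apply Real.sqrt_le_sqrt
      nlinarith
    nlinarith
  · have h1 : √(2 * k * (L - loss t)) ≤ 1.415 * √(k * L) := by
      apply Real.sqrt_le_iff.2
      refine ⟨by positivity, ?_⟩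
      rw [mul_pow, Real.sq_sqrt (mul_nonneg hk0 (by linarith))]
      nlinarith
    linarith

lemma one_le_of_sqrt_sqrt (hx : 100 ≤ √√(k : ℝ)) : 1 ≤ k := by
  rcases Nat.eq_zero_or_pos k with h | h
  · rw [h] at hx; norm_num at hx
  · exact h

lemma pred_div_pow_le (hk : 1 ≤ k) (t : ℕ) :
    (((k - 1 : ℕ) : ℝ) / k) ^ t ≤ 1 - t / k + (t / k) ^ 2 := by
  have hk0 : (0 : ℝ) < k := by exact_mod_cast hk
  have h1 : ((k - 1 : ℕ) : ℝ) / k ≤ Real.exp (-(1 / k)) := by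
    have : ((k - 1 : ℕ) : ℝ) / k = -(1 / k) + 1 := by
      rw [Nat.cast_sub hk, sub_div, Nat.cast_one, div_self hk0.ne']
      ring
    rw [this]
    exact Real.add_one_le_exp _
  have h2 : (((k - 1 : ℕ) : ℝ) / k) ^ t ≤ Real.exp (-(t / k)) := by
    calc (((k - 1 : ℕ) : ℝ) / k) ^ t ≤ Real.exp (-(1 / k)) ^ t := by gcongr
      _ = _ := by rw [← Real.exp_nat_mul]; ring_nf
  refine h2.trans ?_
  have ha0 : (0 : ℝ) ≤ t / k := by positivity
  generalize (t / k : ℝ) = a at ha0 ⊢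
  have h3 : Real.exp (-a) ≤ 1 / (1 + a) := by
    rw [Real.exp_neg, ← one_div]
    apply one_div_le_one_div_of_le (by positivity)
    linarith [Real.add_one_le_exp a]
  refine h3.trans ?_
  rw [div_le_iff₀ (by positivity)]
  nlinarith [pow_nonneg ha0 3]

variable (hx : 100 ≤ √√(k : ℝ)) (hp : 1 ≤ p) (hL : L = Real.log ((p : ℝ) / k))
  (hLt : 100 * loss t ≤ L) (hkL : 4 * Real.log k ≤ t * (L - 3))

lemma strength_add_sq (hLt : 100 * loss t ≤ L) :
    (strength t k L + √√(k : ℝ)) ^ 2 = 2 * k * (L - loss t) := by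
  have hl := loss_pos t
  unfold strength
  rw [sub_add_cancel, Real.sq_sqrt]
  have : (0 : ℝ) ≤ k := Nat.cast_nonneg k
  have : 0 ≤ L - loss t := by linarith
  positivity

lemma natCast_le_exp_of_log {a : ℝ} (hk : 1 ≤ k) (h : Real.log k ≤ a) : (k : ℝ) ≤ Real.exp a := by
  rw [← Real.log_le_iff_le_exp (by exact_mod_cast hk)]
  exact h

/-- The assumptions of the failure bounds hold at the chosen scales. -/
structure Admissible (t k q : ℕ) (m τ : ℝ) : Prop where
  one_le : 1 ≤ k
  log_ge : 8 ≤ Real.log q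
  le_exp : (k : ℝ) ≤ Real.exp (t * Real.log q / 4)
  strength_nonneg : 0 ≤ m
  trunc_nonneg : 0 ≤ τ
  sq_le : (m + τ) ^ 2 ≤ 2 * k * (Real.log q - 2 * 16 ^ t)

include hx hp hL hLt hkL in
lemma admissible : Admissible t k (p / (4 * k)) (strength t k L) (√√(k : ℝ)) := by
  have hl := loss_pos t
  have hk := one_le_of_sqrt_sqrt hx
  have hq := le_log_block hk hp hL (by linarith)
  refine ⟨hk, by linarith, natCast_le_exp_of_log hk ?_, ?_, Real.sqrt_nonneg _, ?_⟩
  · have : (t : ℝ) * (L - 3) ≤ t * Real.log ((p / (4 * k) : ℕ) : ℝ) := by gcongr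
    linarith
  · exact le_trans (by positivity) (strength_bounds hx hLt).1
  · rw [strength_add_sq hLt]
    -- In `loss`, the `3` pays for blocks of size `⌊p / (4k)⌋` instead of `p / k`, and `2 * 16 ^ t`
    -- for large agreements in the second moment.
    have : L - loss t ≤ Real.log ((p / (4 * k) : ℕ) : ℝ) - 2 * 16 ^ t := by
      unfold loss
      linarith
    gcongr

lemma card_sphere_pred_le (hk : 1 ≤ k) (x : SparseVec p k) : (sphere (k - 1) x).card ≤ k * p := by
  refine (card_inter_eq_le x.1 x.2).trans_eq ?_
  rw [Nat.choose_symm hk, Nat.choose_one_right, show k - (k - 1) = 1 by omega,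
    Nat.choose_one_right]

/-- The entropy is about `kL/2`, as half the elements are replaced; `0.6` absorbs the lower-order
terms. -/
lemma card_sphere_half_le (hk : 10 ≤ k) (hp : 1 ≤ p) (hL : L = Real.log ((p : ℝ) / k))
    (h60 : 60 ≤ L) :
    ((k.choose (k / 2) * p.choose (k - k / 2) : ℕ) : ℝ) ≤ Real.exp (0.6 * (k * L)) := by
  have hk0 : (0 : ℝ) < k := by exact_mod_cast (by omega : 0 < k)
  have hkR : (10 : ℝ) ≤ k := by exact_mod_cast hk
  set r := k - k / 2 with hr
  have hr1 : 1 ≤ r := by omega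
  have hr2 : (k : ℝ) ≤ 2 * r := by exact_mod_cast (by omega : k ≤ 2 * r)
  have hr3 : (2 * r : ℝ) ≤ k + 1 := by exact_mod_cast (by omega : 2 * r ≤ k + 1)
  have hr0 : (0 : ℝ) < r := by linarith
  have h1 : (k.choose (k / 2) : ℝ) ≤ Real.exp k := by
    have e1 : (k.choose (k / 2) : ℝ) ≤ 2 ^ k := by
      exact_mod_cast Nat.choose_le_two_pow k (k / 2)
    refine e1.trans ?_
    rw [← mul_one (k : ℝ), Real.exp_nat_mul]
    gcongr
    linarith [Real.add_one_le_exp 1]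
  have h2 : (p.choose r : ℝ) ≤ Real.exp (r * (L + 2)) := by
    refine (choose_mul_pow_le_exp hr1).trans ?_
    have : (p : ℝ) / r ≤ Real.exp (L + 1) := by
      rw [div_le_iff₀ hr0, cast_eq_mul_exp (by omega) hp hL, Real.exp_add]
      have : (2 : ℝ) ≤ Real.exp 1 := by linarith [Real.add_one_le_exp 1]
      calc (k : ℝ) * Real.exp L ≤ 2 * r * Real.exp L := by gcongr
        _ = Real.exp L * 2 * r := by ring
        _ ≤ _ := by gcongr
    calc ((p : ℝ) / r) ^ r * Real.exp r ≤ Real.exp (L + 1) ^ r * Real.exp r := by gcongr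
      _ = _ := by rw [← Real.exp_nat_mul, ← Real.exp_add]; ring_nf
  push_cast
  calc (k.choose (k / 2) : ℝ) * p.choose r ≤ Real.exp k * Real.exp (r * (L + 2)) := by gcongr
    _ = Real.exp (k + r * (L + 2)) := by rw [Real.exp_add]
    _ ≤ _ := by
      apply Real.exp_le_exp.2
      nlinarith

include hx hp hL hLt hkL

/-- Failure bound for nearest neighbors when `t ≥ 3`. -/
theorem sphereBad_pred_le (ht3 : 3 ≤ t) (hxt : 4 * (t * (t + 2) / 2) ≤ √√(k : ℝ))
    (hΔ : 0 ≤ ((t : ℝ) - 2) * L - 4 * Real.log k)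
    (e : Fin k × Fin (p / (4 * k)) ↪ Fin p) :
    stdGaussian (Fin t → Fin p)
      {W | ∀ g, W ∈ sphereBad t (k - 1) (2 / √(k * L)) (transversal e g)} ≤
      ENNReal.ofReal (momentError k (p / (4 * k)) √√(k : ℝ) +
        2 * Real.exp (-((((t : ℝ) - 2) * L - 4 * Real.log k) / 4) +
          (16 * (t * (t + 2) / 2) + t * loss t / 2 + 2))) := by
  have hl := loss_pos t
  obtain ⟨hk, hq, hkq, hm, hτ, hM⟩ := admissible hx hp hL hLt hkL
  have hk0 : (0 : ℝ) < k := by exact_mod_cast hk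
  have ht3' : (3 : ℝ) ≤ t := by exact_mod_cast ht3
  refine (sphereBad_le_of_union_bound (by omega) hk hq hkq hm hτ hM e
    (card_sphere_pred_le hk) (2 / √(k * L))).trans (ENNReal.ofReal_le_ofReal ?_)
  have hp0 : (0 : ℝ) < p := by exact_mod_cast hp
  have hN : ((k * p : ℕ) : ℝ) = Real.exp (2 * Real.log k + L) := by
    rw [two_mul, add_assoc, Real.exp_add, Real.exp_add, Real.exp_log hk0]
    push_cast
    rw [← cast_eq_mul_exp hk hp hL]
  rw [hN, ← Real.exp_add]
  refine add_le_add le_rfl (mul_le_mul_of_nonneg_left (Real.exp_le_exp.2 ?_) zero_le_two)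
  have hub := (strength_bounds hx hLt).2
  have hsq := strength_add_sq (k := k) (t := t) hLt
  set m := strength t k L with hmdef
  set x := √√(k : ℝ) with hxdef
  have hxsq : x ^ 2 = √(k : ℝ) := Real.sq_sqrt (Real.sqrt_nonneg _)
  clear_value x
  set D : ℝ := t * (t + 2) / 2 with hD
  clear_value D
  have hx0 : 0 < x := by linarith
  have hx4 : x ^ 4 = k := by
    rw [show x ^ 4 = (x ^ 2) ^ 2 by ring, hxsq, Real.sq_sqrt hk0.le]
  have hlogk : Real.log k ≤ 4 * x := by
    rw [← hx4, Real.log_pow]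
    push_cast
    linarith [Real.log_le_sub_one_of_pos hx0]
  have hkL0 : 0 < k * L := mul_pos hk0 (by linarith)
  have hmδ : m * (2 / √(k * L)) / 2 ≤ 2 := by
    have h2 : 0 < √(k * L) := Real.sqrt_pos.2 hkL0
    rw [mul_div_assoc', div_div, div_le_iff₀ (by positivity)]
    linarith
  have hm2 : 2 * k * (L - loss t - 2 * L / x) ≤ m ^ 2 := by
    have h1 : m + x ≤ 2 * x ^ 2 * L := by
      refine abs_le_of_sq_le_sq' ?_ ?_ |>.2
      · rw [hsq, ← hx4]
        have : x ^ 4 * (L - loss t) ≤ x ^ 4 * L ^ 2 := by gcongr; nlinarith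
        nlinarith [pow_pos hx0 4]
      · have : 0 ≤ L := by linarith
        positivity
    have h3 : m ^ 2 = 2 * k * (L - loss t) - 2 * x * (m + x) + x ^ 2 := by rw [← hsq]; ring
    have h4 : 2 * (k : ℝ) * (2 * L / x) = 4 * x ^ 3 * L := by
      rw [← hx4]; field_simp; ring
    have h5 : x * (m + x) ≤ x * (2 * x ^ 2 * L) := by gcongr
    nlinarith [sq_nonneg x]
  have hc : (t / k : ℝ) * (1 - t / x) ≤ 1 - (((k - 1 : ℕ) : ℝ) / k) ^ t := by
    have h1 := pred_div_pow_le hk t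
    have h2 : (t / k : ℝ) ≤ t / x := by
      gcongr
      rw [← hx4, ← pow_one x, ← pow_mul]
      exact pow_le_pow_right₀ (by linarith) (by norm_num)
    have h3 : (t / k : ℝ) * (t / k) ≤ t / k * (t / x) := by gcongr
    linarith [sq (t / k : ℝ)]
  -- The Chernoff exponent is about `(2kL / 4) (t / k) = tL/2`; `D * L / x` collects the relative
  -- errors of `m²` and of `1 - c`, both of order `1 / x` with `x = k^(1/4)`.
  have hprod : t / 2 * (L - loss t) - D * L / x ≤
      m ^ 2 / 4 * (1 - (((k - 1 : ℕ) : ℝ) / k) ^ t) := by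
    have htx : t / x ≤ 1 := by
      rw [div_le_one hx0]
      have : (0 : ℝ) ≤ (t : ℝ) * t := by positivity
      have : D = ((t : ℝ) * t + 2 * t) / 2 := by rw [hD]; ring
      linarith
    have h1 : 0 ≤ L - loss t - 2 * L / x := by
      have : 2 * L / x ≤ L / 2 := by
        rw [div_le_iff₀ hx0]
        have : L * 100 ≤ L * x := mul_le_mul_of_nonneg_left hx (by linarith)
        linarith
      linarith
    calc t / 2 * (L - loss t) - D * L / x
        ≤ t / 2 * (L - loss t - 2 * L / x) * (1 - t / x) := by
          have h2 : 0 ≤ t / 2 * (t / x * (loss t + 2 * L / x)) := by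
            have : 0 ≤ L := by linarith
            have : 0 ≤ loss t := by linarith
            positivity
          have h3 : D * L / x = t / 2 * (2 * L / x) + t / 2 * (t / x * L) := by
            rw [hD]; field_simp; ring
          have h4 : t / 2 * (L - loss t - 2 * L / x) * (1 - t / x) =
              t / 2 * (L - loss t) - (t / 2 * (2 * L / x) + t / 2 * (t / x * L)) +
                t / 2 * (t / x * (loss t + 2 * L / x)) := by ring
          rw [h3, h4]
          linarith
      _ = (2 * k * (L - loss t - 2 * L / x)) / 4 * (t / k * (1 - t / x)) := by
          field_simp
          ring
      _ ≤ _ := by gcongr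
  have hLΔ : L ≤ (((t : ℝ) - 2) * L - 4 * Real.log k) + 4 * Real.log k := by
    have : 1 * L ≤ ((t : ℝ) - 2) * L := mul_le_mul_of_nonneg_right (by linarith) (by linarith)
    linarith
  set Δ := ((t : ℝ) - 2) * L - 4 * Real.log k with hΔdef
  -- `L / x` need not be bounded if `k` grows slowly, but `L ≤ Δ + 4 log k ≤ Δ + 16x`, so the error
  -- uses only part of the gain `Δ / 2`.
  have hDL : D * L / x ≤ Δ / 4 + 16 * D := by
    rw [div_le_iff₀ hx0]
    have hD0 : 0 ≤ D := by rw [hD]; positivity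
    calc D * L ≤ D * (Δ + 16 * x) := by gcongr; linarith
      _ ≤ _ := by
        have := mul_le_mul_of_nonneg_right hxt hΔ
        linarith
  have hfin : 2 * Real.log k + L - t / 2 * (L - loss t) = -(Δ / 2) + t * loss t / 2 := by
    rw [hΔdef]; ring
  linarith

/-- Failure bound for nearest neighbors when `t = 2`. -/
theorem sphereBad_two_le (ht2 : t = 2) (hκ : Real.log k ≤ 0.01 * L)
    (e : Fin k × Fin (p / (4 * k)) ↪ Fin p) :
    stdGaussian (Fin t → Fin p)
      {W | ∀ g, W ∈ sphereBad t (k - 1) (2.4 * √(L / k) - 2.2 * √(L / k)) (transversal e g)} ≤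
      ENNReal.ofReal (momentError k (p / (4 * k)) √√(k : ℝ) +
        2 * (2 * Real.exp (-(0.0125 * L)))) := by
  have hl := loss_pos t
  obtain ⟨hk, hq, hkq, hm, hτ, hM⟩ := admissible hx hp hL hLt hkL
  have hk0 : (0 : ℝ) < k := by exact_mod_cast hk
  have hk100 : (100 : ℝ) ≤ k := by
    have hx2 : √√(k : ℝ) ^ 4 = k := by
      rw [show √√(k : ℝ) ^ 4 = (√√(k : ℝ) ^ 2) ^ 2 by ring,
        Real.sq_sqrt (Real.sqrt_nonneg _), Real.sq_sqrt hk0.le]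
    rw [← hx2]
    calc (100 : ℝ) ≤ 100 ^ 4 := by norm_num
      _ ≤ _ := by gcongr
  set u := √(L / k) with hu
  have hu2 : u ^ 2 = L / k := Real.sq_sqrt (div_nonneg (by linarith) hk0.le)
  have hu0 : 0 ≤ u := Real.sqrt_nonneg _
  set c := (((k - 1 : ℕ) : ℝ) / k) ^ t with hc
  have hceq : 1 - c = 2 / k - 1 / k ^ 2 := by
    rw [hc, ht2, Nat.cast_sub hk]
    field_simp
    ring
  have hc1 : 1 - c ≤ 2 / k := by
    rw [hceq]
    have : (0 : ℝ) ≤ 1 / k ^ 2 := by positivity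
    linarith
  have hc2 : 1.99 / k ≤ 1 - c := by
    rw [hceq, div_sub_div _ _ hk0.ne' (by positivity), div_le_div_iff₀ hk0 (by positivity)]
    nlinarith [pow_pos hk0 2]
  have hc0 : 0 < 1 - c := lt_of_lt_of_le (by positivity) hc2
  have hsq : √(k * L) = k * u := by
    rw [hu, Real.sqrt_eq_iff_mul_self_eq (mul_nonneg hk0.le (by linarith)) (by positivity)]
    rw [← hu, show k * u * (k * u) = k ^ 2 * u ^ 2 by ring, hu2]
    field_simp
  -- The planted drop is near `2√2 u`, while the best addition gains about `2u`, up to terms in `log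
  -- k`; `2.4` and `2.2` lie strictly between.
  have hmc : 2.7 * u ≤ strength t k L * (1 - c) := by
    have h1 := (strength_bounds hx hLt).1
    rw [hsq] at h1
    calc 2.7 * u ≤ 1.38 * (k * u) * (1.99 / k) := by
          rw [show 1.38 * (k * u) * (1.99 / k) = 1.38 * 1.99 * u by field_simp]
          gcongr
          norm_num
      _ ≤ _ := by gcongr
  refine (sphereBad_le_of_split (by omega) hk hq hkq hm hτ hM e
    (card_sphere_pred_le hk) (by omega) (θ₁ := 2.4 * u) (θ₂ := 2.2 * u) hc0 (by linarith)
    (by positivity)).trans (ENNReal.ofReal_le_ofReal ?_)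
  rw [← hc]
  have hN : ((k * p : ℕ) : ℝ) = Real.exp (2 * Real.log k + L) := by
    rw [two_mul, add_assoc, Real.exp_add, Real.exp_add, Real.exp_log hk0]
    push_cast
    rw [← cast_eq_mul_exp hk hp hL]
  -- The rate `0.0225` is `0.3² / 4`; subtracting `log k ≤ 0.01 L` for the choice of the removed
  -- element leaves `0.0125`.
  have e1 : 0.0225 * L ≤ (strength t k L * (1 - c) - 2.4 * u) ^ 2 / (2 * (1 - c)) := by
    rw [le_div_iff₀ (by positivity)]
    have h1 : (0.3 * u) ^ 2 ≤ (strength t k L * (1 - c) - 2.4 * u) ^ 2 := by gcongr; linarith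
    have h2 : 0.0225 * L * (2 * (1 - c)) ≤ 0.0225 * L * (2 * (2 / k)) := by
      have : 0 ≤ L := by linarith
      gcongr
    have h3 : 0.0225 * L * (2 * (2 / k)) = (0.3 * u) ^ 2 := by
      rw [mul_pow, hu2]; ring
    linarith
  have e2 : 1.21 * L ≤ (2.2 * u) ^ 2 / (2 * (1 - c)) := by
    rw [le_div_iff₀ (by positivity)]
    have h2 : 1.21 * L * (2 * (1 - c)) ≤ 1.21 * L * (2 * (2 / k)) := by
      have : 0 ≤ L := by linarith
      gcongr
    have h3 : 1.21 * L * (2 * (2 / k)) = (2.2 * u) ^ 2 := by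
      rw [mul_pow, hu2]; ring
    linarith
  have f1 : (k : ℝ) * Real.exp (-((strength t k L * (1 - c) - 2.4 * u) ^ 2 / (2 * (1 - c)))) ≤
      Real.exp (-(0.0125 * L)) := by
    nth_rw 1 [← Real.exp_log hk0]
    rw [← Real.exp_add]
    apply Real.exp_le_exp.2
    linarith
  have f2 : ((k * p : ℕ) : ℝ) * Real.exp (-((2.2 * u) ^ 2 / (2 * (1 - c)))) ≤
      Real.exp (-(0.0125 * L)) := by
    rw [hN, ← Real.exp_add]
    apply Real.exp_le_exp.2
    linarith
  linarith

/-- Failure bound for the sphere halfway from the center when `t ≥ 3`. -/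
theorem sphereBad_half_le (ht3 : 3 ≤ t) (e : Fin k × Fin (p / (4 * k)) ↪ Fin p) :
    stdGaussian (Fin t → Fin p)
      {W | ∀ g, W ∈ sphereBad t (k / 2) (strength t k L / 32) (transversal e g)} ≤
      ENNReal.ofReal (momentError k (p / (4 * k)) √√(k : ℝ) +
        2 * (2 * Real.exp (-(k / 2048)))) := by
  have hl := loss_pos t
  obtain ⟨hk, hq, hkq, hm, hτ, hM⟩ := admissible hx hp hL hLt hkL
  have hk0 : (0 : ℝ) < k := by exact_mod_cast hk
  have hk100 : (100 : ℝ) ≤ k := by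
    have hx2 : √√(k : ℝ) ^ 4 = k := by
      rw [show √√(k : ℝ) ^ 4 = (√√(k : ℝ) ^ 2) ^ 2 by ring,
        Real.sq_sqrt (Real.sqrt_nonneg _), Real.sq_sqrt hk0.le]
    rw [← hx2]
    calc (100 : ℝ) ≤ 100 ^ 4 := by norm_num
      _ ≤ _ := by gcongr
  set m := strength t k L with hmdef
  have hc : (((k / 2 : ℕ) : ℝ) / k) ^ t ≤ 1 / 8 := by
    have h1 : ((k / 2 : ℕ) : ℝ) / k ≤ 1 / 2 := by
      rw [div_le_iff₀ hk0]
      have : ((k / 2 : ℕ) : ℝ) ≤ (k : ℝ) / ((2 : ℕ) : ℝ) := Nat.cast_div_le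
      push_cast at this
      linarith
    calc (((k / 2 : ℕ) : ℝ) / k) ^ t ≤ (1 / 2) ^ t := by gcongr
      _ ≤ (1 / 2) ^ 3 := pow_le_pow_of_le_one (by norm_num) (by norm_num) ht3
      _ = 1 / 8 := by norm_num
  have hs : 13 / 16 * m ≤ m - m / 32 - m / 32 - m * (((k / 2 : ℕ) : ℝ) / k) ^ t := by nlinarith
  refine (sphereBad_le_of_center (by omega) hk hq hkq hm hτ hM e
    (fun x => card_inter_eq_le x.1 x.2) (m / 32) (m / 32) (by linarith)
    (by positivity)).trans (ENNReal.ofReal_le_ofReal ?_)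
  have hm2 : 1.9 * (k * L) ≤ m ^ 2 := by
    have h1 := (strength_bounds hx hLt).1
    have h2 : (1.38 * √(k * L)) ^ 2 ≤ m ^ 2 := by gcongr
    rw [mul_pow, Real.sq_sqrt (mul_nonneg hk0.le (by linarith))] at h2
    nlinarith [mul_pos hk0 (show 0 < L by linarith)]
  have hkL1 : (k : ℝ) ≤ k * L := by nlinarith
  have f1 : Real.exp (-(m / 32) ^ 2 / 2) ≤ Real.exp (-(k / 2048)) := by
    apply Real.exp_le_exp.2
    nlinarith
  have f2 : ((k.choose (k / 2) * p.choose (k - k / 2) : ℕ) : ℝ) *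
      Real.exp (-(m - m / 32 - m / 32 - m * (((k / 2 : ℕ) : ℝ) / k) ^ t) ^ 2 / 2) ≤
      Real.exp (-(k / 2048)) := by
    -- `13/16 = 1 - 1/32 - 1/32 - 1/8`, and `(13/16)² * 1.9 / 2 > 0.62` exceeds the entropy constant
    -- `0.6`.
    have h1 : (13 / 16 * m) ^ 2 ≤
        (m - m / 32 - m / 32 - m * (((k / 2 : ℕ) : ℝ) / k) ^ t) ^ 2 := by gcongr
    calc _ ≤ Real.exp (0.6 * (k * L)) *
        Real.exp (-(m - m / 32 - m / 32 - m * (((k / 2 : ℕ) : ℝ) / k) ^ t) ^ 2 / 2) := by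
          gcongr
          exact card_sphere_half_le (by exact_mod_cast (by linarith : (10 : ℝ) ≤ k)) hp hL
            (by linarith)
      _ ≤ _ := by
          rw [← Real.exp_add]
          apply Real.exp_le_exp.2
          nlinarith
  linarith

end Scales

/-! ### Comparing the barriers with `b` to get mixing times of order `p ^ c`. -/

section Rates

variable {p k t : ℕ} {L : ℝ}

/-- The factor by which `b` has to exceed its threshold for mixing times of order `p ^ c`. -/
def rateFactor (t : ℕ) (c : ℝ) : ℝ := 25 * (2 + t / 2 + (t / 4 + 1) * c)

lemma cast_rpow_eq (hk : 1 ≤ k) (hp : 1 ≤ p) (hL : L = Real.log ((p : ℝ) / k)) (c : ℝ) :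
    (p : ℝ) ^ c = Real.exp ((Real.log k + L) * c) := by
  have hk0 : (0 : ℝ) < k := by exact_mod_cast hk
  rw [Real.exp_mul, Real.exp_add, Real.exp_log hk0, ← cast_eq_mul_exp hk hp hL]

lemma four_le_exp_two : (4 : ℝ) ≤ Real.exp 2 := by
  have h : Real.exp 2 = Real.exp 1 * Real.exp 1 := by rw [← Real.exp_add]; norm_num
  nlinarith [Real.add_one_le_exp 1]

lemma four_mul_mul_rpow_le (hk : 1 ≤ k) (hp : 1 ≤ p) (hL : L = Real.log ((p : ℝ) / k))
    (h2 : 2 ≤ L) (hkL : 4 * Real.log k ≤ t * (L - 3)) {c : ℝ} (hc : 0 ≤ c) :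
    4 * ((k * p : ℕ) : ℝ) * (p : ℝ) ^ c ≤ Real.exp (rateFactor t c / 25 * L) := by
  have hk0 : (0 : ℝ) < k := by exact_mod_cast hk
  have hN : ((k * p : ℕ) : ℝ) = Real.exp (2 * Real.log k + L) := by
    rw [two_mul, add_assoc, Real.exp_add, Real.exp_add, Real.exp_log hk0]
    push_cast
    rw [← cast_eq_mul_exp hk hp hL]
  rw [hN, cast_rpow_eq hk hp hL]
  calc _ ≤ Real.exp 2 * Real.exp (2 * Real.log k + L) * Real.exp ((Real.log k + L) * c) := by
        gcongr
        exact four_le_exp_two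
    _ = Real.exp (2 + (2 * Real.log k + L) + (Real.log k + L) * c) := by
        rw [Real.exp_add (2 + (2 * Real.log k + L)), Real.exp_add 2]
    _ ≤ _ := by
        apply Real.exp_le_exp.2
        have ht0 : (0 : ℝ) ≤ t := Nat.cast_nonneg t
        have h4 : Real.log k ≤ t / 4 * L := by linarith
        have h5 : (Real.log k + L) * c ≤ (t / 4 * L + L) * c := by gcongr
        unfold rateFactor
        linarith

variable (hx : 100 ≤ √√(k : ℝ)) (hp : 1 ≤ p) (hL : L = Real.log ((p : ℝ) / k))
  (hLt : 100 * loss t ≤ L) (hkL : 4 * Real.log k ≤ t * (L - 3)) {lam b c : ℝ}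
  (hlam : 0 ≤ lam) (hc : 0 ≤ c)

include hx hp hL hLt hkL hlam hc

/-- The noise barrier `2 / √(kL)` loses at most half to the signal; multiplied by `b` it is still a
large multiple of `L`, which dominates `log (kp)` and `c log p`. -/
lemma model_compl_le_of_pred (ht3 : 3 ≤ t) (hxt : 4 * (t * (t + 2) / 2) ≤ √√(k : ℝ))
    (hΔ : 0 ≤ ((t : ℝ) - 2) * L - 4 * Real.log k)
    (hlk : lam * (1 / k) ^ t ≤ 1 / √(k * L)) (hb : rateFactor t c * (L * √(k * L)) ≤ b) :
    model t p k (slowMixing t p k lam b c)ᶜ ≤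
      2 * ENNReal.ofReal (momentError k (p / (4 * k)) √√(k : ℝ) +
        2 * Real.exp (-((((t : ℝ) - 2) * L - 4 * Real.log k) / 4) +
          (16 * (t * (t + 2) / 2) + t * loss t / 2 + 2))) := by
  have hl := loss_pos t
  have hk := one_le_of_sqrt_sqrt hx
  have hk0 : (0 : ℝ) < k := by exact_mod_cast hk
  have hS : 0 < √(k * L) := Real.sqrt_pos.2 (mul_pos hk0 (by linarith))
  have hr0 : 0 ≤ rateFactor t c := by unfold rateFactor; positivity
  have hb0 : 0 ≤ b := le_trans (mul_nonneg hr0 (mul_nonneg (by linarith) hS.le)) hb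
  have hcast : ((k - (k - 1) : ℕ) : ℝ) = 1 := by
    rw [show k - (k - 1) = 1 by omega, Nat.cast_one]
  have hδ : 1 / √(k * L) ≤ 2 / √(k * L) - lam * (1 / k) ^ t := by
    have : 2 / √(k * L) = 1 / √(k * L) + 1 / √(k * L) := by ring
    linarith
  have hδ0 : 0 ≤ 1 / √(k * L) := by positivity
  refine model_slowMixing_compl_le (q := p / (4 * k)) (l := k - 1) (δ := 2 / √(k * L))
    (N := k * p) (by omega) (by omega) (by omega) (blocks_fit hk hp hL (by linarith))
    (card_sphere_pred_le hk) hlam hb0 ?_ ?_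
    (sphereBad_pred_le hx hp hL hLt hkL ht3 hxt hΔ)
  · rw [hcast]
    linarith
  · rw [hcast]
    refine (four_mul_mul_rpow_le (t := t) hk hp hL (by linarith) hkL hc).trans
      (Real.exp_le_exp.2 ?_)
    calc rateFactor t c / 25 * L ≤ rateFactor t c * L := by
          have : 0 ≤ L := by linarith
          gcongr
          linarith
      _ = rateFactor t c * (L * √(k * L)) * (1 / √(k * L)) := by
          rw [mul_assoc, mul_assoc, mul_one_div_cancel hS.ne', mul_one]
      _ ≤ _ := mul_le_mul hb hδ hδ0 hb0

lemma model_compl_le_of_two (ht2 : t = 2) (hκ : Real.log k ≤ 0.01 * L)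
    (hlk : lam * (1 / k) ^ t ≤ 1 / √(k * L)) (hb : rateFactor t c * √(k * L) ≤ b) :
    model t p k (slowMixing t p k lam b c)ᶜ ≤
      2 * ENNReal.ofReal (momentError k (p / (4 * k)) √√(k : ℝ) +
        2 * (2 * Real.exp (-(0.0125 * L)))) := by
  have hl := loss_pos t
  have hk := one_le_of_sqrt_sqrt hx
  have hk0 : (0 : ℝ) < k := by exact_mod_cast hk
  have hL0 : 0 < L := by linarith
  have hS : 0 < √(k * L) := Real.sqrt_pos.2 (mul_pos hk0 hL0)
  have hr0 : 0 ≤ rateFactor t c := by unfold rateFactor; positivity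
  have hb0 : 0 ≤ b := le_trans (mul_nonneg hr0 hS.le) hb
  have hcast : ((k - (k - 1) : ℕ) : ℝ) = 1 := by
    rw [show k - (k - 1) = 1 by omega, Nat.cast_one]
  set u := √(L / k) with hu
  have hu0 : 0 ≤ u := Real.sqrt_nonneg _
  have hSu : √(k * L) * u = L := by
    rw [hu, ← Real.sqrt_mul (mul_nonneg hk0.le hL0.le), show k * L * (L / k) = L * L by field_simp,
      Real.sqrt_mul_self hL0.le]
  have hδ : 0.1 * u ≤ 2.4 * u - 2.2 * u - lam * (1 / k) ^ t := by
    have : 1 / √(k * L) ≤ 0.1 * u := by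
      rw [div_le_iff₀ hS]
      linarith
    linarith
  have hδ0 : 0 ≤ 0.1 * u := by positivity
  refine model_slowMixing_compl_le (q := p / (4 * k)) (l := k - 1) (δ := 2.4 * u - 2.2 * u)
    (N := k * p) (by omega) (by omega) (by omega) (blocks_fit hk hp hL (by linarith))
    (card_sphere_pred_le hk) hlam hb0 ?_ ?_
    (sphereBad_two_le hx hp hL hLt hkL ht2 hκ)
  · rw [hcast]
    linarith
  · rw [hcast]
    refine (four_mul_mul_rpow_le (t := t) hk hp hL (by linarith) hkL hc).trans
      (Real.exp_le_exp.2 ?_)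
    calc rateFactor t c / 25 * L ≤ rateFactor t c * 0.1 * L := by
          have := mul_nonneg hr0 hL0.le
          linarith
      _ = rateFactor t c * √(k * L) * (0.1 * u) := by
          rw [show rateFactor t c * √(k * L) * (0.1 * u) =
            rateFactor t c * 0.1 * (√(k * L) * u) by ring, hSu]
      _ ≤ _ := mul_le_mul hb hδ hδ0 hb0

lemma model_compl_le_of_half (ht3 : 3 ≤ t) (hL6 : 10 ^ 6 ≤ L) (hlk : lam ≤ √(k : ℝ))
    (hb : rateFactor t c * √(k * L) ≤ b) :
    model t p k (slowMixing t p k lam b c)ᶜ ≤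
      2 * ENNReal.ofReal (momentError k (p / (4 * k)) √√(k : ℝ) +
        2 * (2 * Real.exp (-(k / 2048)))) := by
  have hl := loss_pos t
  have hk := one_le_of_sqrt_sqrt hx
  have hk0 : (0 : ℝ) < k := by exact_mod_cast hk
  have hk10 : 10 ≤ k := by
    have hx2 : √√(k : ℝ) ^ 4 = k := by
      rw [show √√(k : ℝ) ^ 4 = (√√(k : ℝ) ^ 2) ^ 2 by ring,
        Real.sq_sqrt (Real.sqrt_nonneg _), Real.sq_sqrt hk0.le]
    have : (10 : ℝ) ≤ k := by
      rw [← hx2]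
      calc (10 : ℝ) ≤ 100 ^ 4 := by norm_num
        _ ≤ _ := by gcongr
    exact_mod_cast this
  have hL0 : 0 < L := by linarith
  have hS : 0 < √(k * L) := Real.sqrt_pos.2 (mul_pos hk0 hL0)
  have hS2 : √(k * L) * √(k * L) = k * L := Real.mul_self_sqrt (mul_pos hk0 hL0).le
  have hr0 : 0 ≤ rateFactor t c := by unfold rateFactor; positivity
  have hb0 : 0 ≤ b := le_trans (mul_nonneg hr0 hS.le) hb
  -- The signal is at most `√k`, and `1.38 / 32 - 0.003 ≥ 0.04 = 1 / 25`, which is the source of the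
  -- factor `25` in `rateFactor`.
  have hsk : √(k : ℝ) ≤ 0.003 * √(k * L) := by
    rw [Real.sqrt_le_iff]
    refine ⟨by positivity, ?_⟩
    rw [mul_pow, sq √(k * L), hS2]
    nlinarith
  have hm := (strength_bounds hx hLt).1
  have hratio : lam * (((k - k / 2 : ℕ) : ℝ) / k) ^ t ≤ √(k : ℝ) := by
    refine (mul_le_of_le_one_right hlam (pow_le_one₀ (by positivity) ?_)).trans hlk
    rw [div_le_one hk0]
    exact_mod_cast Nat.sub_le k (k / 2)
  have hδ : 0.04 * √(k * L) ≤
      strength t k L / 32 - lam * (((k - k / 2 : ℕ) : ℝ) / k) ^ t := by linarith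
  have hδ0 : 0 ≤ 0.04 * √(k * L) := by positivity
  refine model_slowMixing_compl_le (q := p / (4 * k)) (l := k / 2) (δ := strength t k L / 32)
    (N := k.choose (k / 2) * p.choose (k - k / 2)) (by omega) (by omega) (by omega)
    (blocks_fit hk hp hL (by linarith)) (fun x => card_inter_eq_le x.1 x.2) hlam hb0
    (hδ0.trans hδ) ?_ (sphereBad_half_le hx hp hL hLt hkL ht3)
  calc _ ≤ Real.exp 2 * Real.exp (0.6 * (k * L)) * Real.exp ((Real.log k + L) * c) := by
        rw [cast_rpow_eq hk hp hL]
        gcongr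
        · exact four_le_exp_two
        · exact card_sphere_half_le hk10 hp hL (by linarith)
    _ = Real.exp (2 + 0.6 * (k * L) + (Real.log k + L) * c) := by
        rw [Real.exp_add, Real.exp_add]
    _ ≤ _ := by
        apply Real.exp_le_exp.2
        have ht0 : (0 : ℝ) ≤ t := Nat.cast_nonneg t
        have hkL1 : L ≤ k * L := le_mul_of_one_le_left hL0.le (by exact_mod_cast hk)
        have h4 : Real.log k ≤ t / 4 * L := by linarith
        have h5 : (Real.log k + L) * c ≤ (t / 4 * (k * L) + k * L) * c := by
          have : t / 4 * L ≤ t / 4 * (k * L) := by gcongr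
          gcongr
          linarith
        calc 2 + 0.6 * (k * L) + (Real.log k + L) * c
            ≤ rateFactor t c / 25 * (k * L) := by
              have : 0 ≤ t / 2 * (k * L) := by positivity
              unfold rateFactor
              linarith
          _ = rateFactor t c * √(k * L) * (0.04 * √(k * L)) := by
            rw [show rateFactor t c * √(k * L) * (0.04 * √(k * L)) =
              rateFactor t c / 25 * (√(k * L) * √(k * L)) by ring, hS2]
          _ ≤ _ := mul_le_mul hb hδ hδ0 hb0

end Rates

/-! ### Asymptotics, and letting the exponent grow. -/

section Limits

/-- Diagonal choice: bounds for each fixed exponent are upgraded to an exponent growing slowly with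
`p`. -/
lemma exists_tendsto_diagonal {f : ℕ → ℕ → ℝ≥0∞} (h : ∀ K, Tendsto (f K) atTop (𝓝 0)) :
    ∃ c : ℕ → ℕ, Tendsto c atTop atTop ∧ Tendsto (fun p => f (c p) p) atTop (𝓝 0) := by
  have h1 : ∀ K : ℕ, ∃ n : ℕ, ∀ p ≥ n, f K p ≤ ((K : ℝ≥0∞) + 1)⁻¹ := by
    intro K
    have hpos : (0 : ℝ≥0∞) < ((K : ℝ≥0∞) + 1)⁻¹ :=
      ENNReal.inv_pos.2 (ENNReal.add_ne_top.2 ⟨ENNReal.natCast_ne_top K, ENNReal.one_ne_top⟩)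
    exact eventually_atTop.1 ((h K).eventually_le_const hpos)
  choose n hn using h1
  have hc : Tendsto (fun p => Nat.findGreatest (fun K => n K ≤ p) p) atTop atTop := by
    refine tendsto_atTop.2 fun K => ?_
    filter_upwards [eventually_ge_atTop (max K (n K))] with p hp
    exact Nat.le_findGreatest (le_trans (le_max_left _ _) hp) (le_trans (le_max_right _ _) hp)
  refine ⟨_, hc, ?_⟩
  have hlim : Tendsto (fun p =>
      (((Nat.findGreatest (fun K => n K ≤ p) p : ℕ) : ℝ≥0∞) + 1)⁻¹) atTop (𝓝 0) := by
    have h2 : Tendsto (fun K : ℕ => ((K : ℝ≥0∞) + 1)⁻¹) atTop (𝓝 0) := by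
      have := (tendsto_add_atTop_iff_nat 1).2 ENNReal.tendsto_inv_nat_nhds_zero
      simpa using this
    exact h2.comp hc
  refine tendsto_of_tendsto_of_tendsto_of_le_of_le' tendsto_const_nhds hlim
    (Eventually.of_forall fun _ => zero_le) ?_
  -- Below `n 0` the value `0` of `Nat.findGreatest` may be its default, for which the bound is not
  -- guaranteed.
  filter_upwards [eventually_ge_atTop (n 0)] with p hp
  exact hn _ p (Nat.findGreatest_spec (P := fun K => n K ≤ p) (Nat.zero_le p) hp)

lemma tendsto_momentError {k q : ℕ → ℕ} (hk : Tendsto k atTop atTop)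
    (hq : Tendsto (fun p => Real.log (q p)) atTop atTop) :
    Tendsto (fun p => momentError (k p) (q p) √√(k p : ℝ)) atTop (𝓝 0) := by
  have hkR : Tendsto (fun p => (k p : ℝ)) atTop atTop := tendsto_natCast_atTop_atTop.comp hk
  have h1 : Tendsto (fun x : ℝ => 2 * x * Real.exp (-(x / 2))) atTop (𝓝 0) := by
    have := (Real.tendsto_pow_mul_exp_neg_atTop_nhds_zero 1).comp
      (tendsto_id.atTop_div_const (show (0 : ℝ) < 2 by norm_num))
    have h := this.const_mul 4
    rw [mul_zero] at h
    refine h.congr fun x => ?_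
    simp only [Function.comp, id, pow_one]
    ring
  have h2 : Tendsto (fun x : ℝ => Real.exp (-(x / 4))) atTop (𝓝 0) :=
    Real.tendsto_exp_neg_atTop_nhds_zero.comp
      (tendsto_id.atTop_div_const (show (0 : ℝ) < 4 by norm_num))
  have h3 : Tendsto (fun x : ℝ => x * Real.exp (-x)) atTop (𝓝 0) := by
    simpa using Real.tendsto_pow_mul_exp_neg_atTop_nhds_zero 1
  have h4 : Tendsto (fun x : ℝ => Real.exp (-√√x ^ 2 / 2)) atTop (𝓝 0) := by
    have := Real.tendsto_exp_neg_atTop_nhds_zero.comp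
      (Real.tendsto_sqrt_atTop.atTop_div_const (show (0 : ℝ) < 2 by norm_num))
    refine this.congr fun x => ?_
    simp only [Function.comp]
    rw [Real.sq_sqrt (Real.sqrt_nonneg _), neg_div]
  have h5 := ((((Real.continuous_exp.tendsto 0).comp (h1.comp hq)).add
    (((h2.comp hq).const_mul 2).add (h3.comp hkR))).sub_const 1).add ((h4.comp hkR).const_mul 2)
  have h6 := h5.const_mul 4
  simp only [Real.exp_zero, mul_zero, add_zero, sub_self] at h6
  exact h6

/-- At `lam = √κ` the powers of `κ` combine to `√κ`, and the exponent of `L` is at least `3/2`. -/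
lemma rpow_threshold_ge {t : ℕ} (ht : 3 ≤ t) {κ L lam : ℝ} (hκ : 1 ≤ κ) (hL : 1 ≤ L)
    (hlam : √κ ≤ lam) :
    L * √(κ * L) ≤ lam ^ (1 / ((t : ℝ) - 1)) * κ ^ (((t : ℝ) - 2) / (2 * ((t : ℝ) - 1))) *
      L ^ ((3 * (t : ℝ) - 2) / (2 * ((t : ℝ) - 1))) := by
  have ht' : (3 : ℝ) ≤ t := by exact_mod_cast ht
  have ht1 : (0 : ℝ) < t - 1 := by linarith
  have hκ0 : 0 < κ := by linarith
  have hL0 : 0 < L := by linarith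
  have h1 : (√κ) ^ (1 / ((t : ℝ) - 1)) ≤ lam ^ (1 / ((t : ℝ) - 1)) :=
    Real.rpow_le_rpow (Real.sqrt_nonneg _) hlam (by positivity)
  have h2 : (√κ) ^ (1 / ((t : ℝ) - 1)) * κ ^ (((t : ℝ) - 2) / (2 * ((t : ℝ) - 1))) = √κ := by
    rw [Real.sqrt_eq_rpow, ← Real.rpow_mul hκ0.le, ← Real.rpow_add hκ0]
    congr 1
    field_simp
    ring
  have h3 : L * √L ≤ L ^ ((3 * (t : ℝ) - 2) / (2 * ((t : ℝ) - 1))) := by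
    rw [Real.sqrt_eq_rpow]
    nth_rw 1 [← Real.rpow_one L]
    rw [← Real.rpow_add hL0]
    apply Real.rpow_le_rpow_of_exponent_le hL
    rw [le_div_iff₀ (by positivity)]
    linarith
  calc L * √(κ * L) = (√κ) ^ (1 / ((t : ℝ) - 1)) *
        κ ^ (((t : ℝ) - 2) / (2 * ((t : ℝ) - 1))) * (L * √L) := by
        rw [h2, Real.sqrt_mul hκ0.le]; ring
    _ ≤ _ := by
      have : 0 ≤ lam := (Real.sqrt_nonneg κ).trans hlam
      gcongr

lemma rpow_mul_pow_le {t k : ℕ} (hk : 1 ≤ k) {L lam : ℝ} (hL : 0 < L)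
    (hlam : lam ≤ 1 / √L * (k : ℝ) ^ ((t : ℝ) - 1 / 2)) :
    lam * (1 / k) ^ t ≤ 1 / √(k * L) := by
  have hk0 : (0 : ℝ) < k := by exact_mod_cast hk
  calc lam * (1 / k) ^ t ≤ 1 / √L * (k : ℝ) ^ ((t : ℝ) - 1 / 2) * (1 / k) ^ t := by gcongr
    _ = 1 / √(k * L) := by
      have hs : 0 < √L := Real.sqrt_pos.2 hL
      have hsk : 0 < √(k : ℝ) := Real.sqrt_pos.2 hk0
      rw [Real.sqrt_mul hk0.le, Real.rpow_sub hk0, Real.rpow_natCast, ← Real.sqrt_eq_rpow,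
        _root_.one_div_pow]
      field_simp

lemma eventually_mul_le_of_tendsto_div {b d : ℕ → ℝ} (h : Tendsto (fun p => b p / d p) atTop atTop)
    (A : ℝ) (hd : ∀ᶠ p in atTop, 0 < d p) : ∀ᶠ p in atTop, A * d p ≤ b p := by
  filter_upwards [h.eventually_ge_atTop A, hd] with p h1 h2
  exact (le_div_iff₀ h2).1 h1

lemma tendsto_two_mul_ofReal {f : ℕ → ℝ} (h : Tendsto f atTop (𝓝 0)) :
    Tendsto (fun p => 2 * ENNReal.ofReal (f p)) atTop (𝓝 0) := by
  have := ENNReal.Tendsto.const_mul (a := 2) (ENNReal.tendsto_ofReal h) (Or.inr ENNReal.ofNat_ne_top)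
  simpa using this

/-- With the exponent `c` of the mixing time bound fixed, slow mixing holds with high
probability. -/
theorem tendsto_model_slowMixing_compl {t : ℕ} {k : ℕ → ℕ} {lam b : ℕ → ℝ}
    (hk : Tendsto k atTop atTop)
    (hcases : (t = 2 ∧ ∀ᶠ p : ℕ in atTop, (k p : ℝ) ≤ (p : ℝ) ^ (1 / 101 : ℝ)) ∨
        (3 ≤ t ∧ (fun p : ℕ => (k p : ℝ)) =o[atTop]
          fun p : ℕ => (p : ℝ) ^ (((t : ℝ) - 2) / ((t : ℝ) + 2))))
    (hlam : ∀ p, 0 < lam p)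
    (hlam' : lam =o[atTop] (fun p : ℕ => 1 / √(Real.log ((p : ℝ) / k p)) *
        min ((k p : ℝ) ^ ((t : ℝ) - 1 / 2))
          ((p : ℝ) ^ ((t : ℝ) - 1) / (k p : ℝ) ^ ((t : ℝ) - 3 / 2))))
    (hb1 : Tendsto (fun p : ℕ => b p /
        (lam p ^ (1 / ((t : ℝ) - 1)) *
          (k p : ℝ) ^ (((t : ℝ) - 2) / (2 * ((t : ℝ) - 1))) *
          Real.log ((p : ℝ) / k p) ^ ((3 * (t : ℝ) - 2) / (2 * ((t : ℝ) - 1)))))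
        atTop atTop)
    (hb2 : Tendsto (fun p : ℕ => b p / √(k p * Real.log ((p : ℝ) / k p))) atTop atTop)
    {c : ℝ} (hc : 0 ≤ c) :
    Tendsto (fun p => model t p (k p) (slowMixing t p (k p) (lam p) (b p) c)ᶜ) atTop (𝓝 0) := by
  set L : ℕ → ℝ := fun p => Real.log ((p : ℝ) / k p) with hLdef
  have hkR : Tendsto (fun p => (k p : ℝ)) atTop atTop := tendsto_natCast_atTop_atTop.comp hk
  have hk1 : ∀ᶠ p in atTop, 1 ≤ k p := hk.eventually_ge_atTop 1
  have hp1 : ∀ᶠ p : ℕ in atTop, 1 ≤ p := eventually_ge_atTop 1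
  have hlogp : Tendsto (fun p : ℕ => Real.log p) atTop atTop :=
    Real.tendsto_log_atTop.comp tendsto_natCast_atTop_atTop
  have hlogp_eq : ∀ᶠ p : ℕ in atTop, Real.log (p : ℝ) = Real.log (k p) + L p := by
    filter_upwards [hk1, hp1] with p h1 h2
    have h1' : (0 : ℝ) < k p := by exact_mod_cast h1
    have h2' : (0 : ℝ) < p := by exact_mod_cast h2
    rw [hLdef]
    simp only
    rw [Real.log_div h2'.ne' h1'.ne']
    ring
  have hκ2 : t = 2 → ∀ᶠ p in atTop, Real.log (k p) ≤ 0.01 * L p := by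
    rintro rfl
    obtain ⟨-, h⟩ | ⟨h, -⟩ := hcases
    · filter_upwards [h, hk1, hp1, hlogp_eq] with p h0 h1 h2 h3
      have h1' : (0 : ℝ) < k p := by exact_mod_cast h1
      have h2' : (0 : ℝ) < p := by exact_mod_cast h2
      have h4 := Real.log_le_log h1' h0
      rw [Real.log_rpow h2', h3] at h4
      linarith
    · omega
  -- Since `L = log p - log k`, this quantity is `(t - 2) log p - (t + 2) log k`, so the sparsity
  -- assumption is exactly its divergence.
  have hΔ3 : 3 ≤ t → Tendsto (fun p => ((t : ℝ) - 2) * L p - 4 * Real.log (k p)) atTop atTop := by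
    intro ht
    have ht' : (3 : ℝ) ≤ t := by exact_mod_cast ht
    obtain ⟨h, -⟩ | ⟨-, h⟩ := hcases
    · omega
    refine tendsto_atTop.2 fun A => ?_
    filter_upwards [h.bound (Real.exp_pos (-(A / ((t : ℝ) + 2)))), hk1, hp1, hlogp_eq]
      with p h0 h1 h2 h3
    have h1' : (0 : ℝ) < k p := by exact_mod_cast h1
    have h2' : (0 : ℝ) < p := by exact_mod_cast h2
    rw [Real.norm_of_nonneg h1'.le, Real.norm_of_nonneg (Real.rpow_nonneg h2'.le _)] at h0
    have h4 := Real.log_le_log h1' h0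
    rw [Real.log_mul (Real.exp_pos _).ne' (Real.rpow_pos_of_pos h2' _).ne', Real.log_exp,
      Real.log_rpow h2', h3] at h4
    have h5 : (0 : ℝ) < t + 2 := by linarith
    have h6 := mul_le_mul_of_nonneg_left h4 h5.le
    have h7 : ((t : ℝ) + 2) * (-(A / ((t : ℝ) + 2)) +
        ((t : ℝ) - 2) / ((t : ℝ) + 2) * (Real.log (k p) + L p)) =
        -A + ((t : ℝ) - 2) * (Real.log (k p) + L p) := by field_simp
    rw [h7] at h6
    linarith
  have ht2 : 2 ≤ t := by rcases hcases with ⟨h, -⟩ | ⟨h, -⟩ <;> omega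
  have hLtop : Tendsto L atTop atTop := by
    rcases ht2.eq_or_lt with h | h
    · refine tendsto_atTop_mono' _ ?_ (hlogp.const_mul_atTop (show (0 : ℝ) < 1 / 2 by norm_num))
      filter_upwards [hκ2 h.symm, hlogp_eq, hk1] with p h1 h2 h3
      have : 0 ≤ Real.log (k p) := Real.log_natCast_nonneg _
      linarith
    · have ht' : (3 : ℝ) ≤ t := by exact_mod_cast h
      have h1 := (hΔ3 h).atTop_div_const (show (0 : ℝ) < t - 2 by linarith)
      refine tendsto_atTop_mono' _ ?_ h1
      filter_upwards with p
      have : 0 ≤ Real.log (k p) := Real.log_natCast_nonneg _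
      rw [div_le_iff₀ (by linarith)]
      linarith
  have hkL : ∀ᶠ p in atTop, 4 * Real.log (k p) ≤ t * (L p - 3) := by
    rcases ht2.eq_or_lt with h | h
    · filter_upwards [hκ2 h.symm, hLtop.eventually_ge_atTop 100] with p h1 h2
      rw [← h]
      push_cast
      linarith
    · filter_upwards [(hΔ3 h).eventually_ge_atTop 0, hLtop.eventually_ge_atTop (3 * t)]
        with p h1 h2
      linarith
  have hx : Tendsto (fun p => √√(k p : ℝ)) atTop atTop :=
    Real.tendsto_sqrt_atTop.comp (Real.tendsto_sqrt_atTop.comp hkR)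
  have hLt := hLtop.eventually_ge_atTop (100 * loss t)
  have hlk : ∀ᶠ p in atTop, lam p * (1 / k p) ^ t ≤ 1 / √(k p * L p) := by
    filter_upwards [hlam'.bound one_pos, hk1, hLtop.eventually_gt_atTop 0, hp1] with p h1 h2 h3 h4
    refine rpow_mul_pow_le h2 h3 ?_
    rw [one_mul, Real.norm_of_nonneg (hlam p).le, Real.norm_of_nonneg (by positivity)] at h1
    refine h1.trans ?_
    gcongr
    exact min_le_left _ _
  have hq : Tendsto (fun p => Real.log ((p / (4 * k p) : ℕ) : ℝ)) atTop atTop := by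
    refine tendsto_atTop_mono' _ ?_ (tendsto_atTop_add_const_right _ (-3) hLtop)
    filter_upwards [hk1, hp1, hLtop.eventually_ge_atTop 7] with p h1 h2 h3
    have := le_log_block h1 h2 rfl h3
    linarith
  have hM := tendsto_momentError hk hq
  have hbS : ∀ᶠ p in atTop, rateFactor t c * √(k p * L p) ≤ b p := by
    refine eventually_mul_le_of_tendsto_div hb2 _ ?_
    filter_upwards [hk1, hLtop.eventually_gt_atTop 0] with p h1 h2
    have h1' : (0 : ℝ) < k p := by exact_mod_cast h1
    exact Real.sqrt_pos.2 (mul_pos h1' h2)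
  rcases ht2.eq_or_lt with h | h
  · have hE : Tendsto (fun p => momentError (k p) (p / (4 * k p)) √√(k p : ℝ) +
        2 * (2 * Real.exp (-(0.0125 * L p)))) atTop (𝓝 0) := by
      have h1 := Real.tendsto_exp_neg_atTop_nhds_zero.comp
        (hLtop.const_mul_atTop (show (0 : ℝ) < 0.0125 by norm_num))
      have h2 := hM.add ((h1.const_mul 2).const_mul 2)
      simp only [mul_zero, add_zero] at h2
      exact h2
    refine tendsto_of_tendsto_of_tendsto_of_le_of_le' tendsto_const_nhds
      (tendsto_two_mul_ofReal hE) (Eventually.of_forall fun _ => zero_le) ?_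
    filter_upwards [hx.eventually_ge_atTop 100, hp1, hLt, hkL, hκ2 h.symm, hlk, hbS]
      with p h1 h2 h3 h4 h5 h6 h7
    exact model_compl_le_of_two h1 h2 rfl h3 h4 (hlam p).le hc h.symm h5 h6 h7
  · have hE1 : Tendsto (fun p => momentError (k p) (p / (4 * k p)) √√(k p : ℝ) +
        2 * Real.exp (-((((t : ℝ) - 2) * L p - 4 * Real.log (k p)) / 4) +
          (16 * (t * (t + 2) / 2) + t * loss t / 2 + 2))) atTop (𝓝 0) := by
      have h1 := (Real.tendsto_exp_neg_atTop_nhds_zero.comp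
        ((hΔ3 h).atTop_div_const (show (0 : ℝ) < 4 by norm_num))).mul_const
          (Real.exp (16 * (t * (t + 2) / 2) + t * loss t / 2 + 2))
      have h2 := hM.add (h1.const_mul 2)
      simp only [mul_zero, add_zero, zero_mul] at h2
      refine h2.congr fun p => ?_
      rw [Real.exp_add (-((((t : ℝ) - 2) * L p - 4 * Real.log (k p)) / 4))]
      rfl
    have hE2 : Tendsto (fun p => momentError (k p) (p / (4 * k p)) √√(k p : ℝ) +
        2 * (2 * Real.exp (-((k p : ℝ) / 2048)))) atTop (𝓝 0) := by
      have h1 := Real.tendsto_exp_neg_atTop_nhds_zero.comp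
        (hkR.atTop_div_const (show (0 : ℝ) < 2048 by norm_num))
      have h2 := hM.add ((h1.const_mul 2).const_mul 2)
      simp only [mul_zero, add_zero] at h2
      exact h2
    have hE := (tendsto_two_mul_ofReal hE1).add (tendsto_two_mul_ofReal hE2)
    rw [add_zero] at hE
    refine tendsto_of_tendsto_of_tendsto_of_le_of_le' tendsto_const_nhds hE
      (Eventually.of_forall fun _ => zero_le) ?_
    have hb3 : ∀ᶠ p in atTop, √(k p : ℝ) ≤ lam p →
        rateFactor t c * (L p * √(k p * L p)) ≤ b p := by
      have hpos : ∀ᶠ p in atTop, 0 < lam p ^ (1 / ((t : ℝ) - 1)) *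
          (k p : ℝ) ^ (((t : ℝ) - 2) / (2 * ((t : ℝ) - 1))) *
          L p ^ ((3 * (t : ℝ) - 2) / (2 * ((t : ℝ) - 1))) := by
        filter_upwards [hk1, hLtop.eventually_gt_atTop 0] with p h1 h2
        have h1' : (0 : ℝ) < k p := by exact_mod_cast h1
        have := hlam p
        positivity
      filter_upwards [eventually_mul_le_of_tendsto_div hb1 (rateFactor t c) hpos, hk1,
        hLtop.eventually_ge_atTop 1] with p h1 h2 h3 h4
      refine le_trans ?_ h1
      have : 0 ≤ rateFactor t c := by unfold rateFactor; positivity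
      exact mul_le_mul_of_nonneg_left
        (rpow_threshold_ge h (by exact_mod_cast h2) h3 h4) this
    filter_upwards [hx.eventually_ge_atTop 100, hp1, hLt, hkL, hlk, hbS, hb3,
      hx.eventually_ge_atTop (4 * (t * (t + 2) / 2)), (hΔ3 h).eventually_ge_atTop 0,
      hLtop.eventually_ge_atTop (10 ^ 6)] with p h1 h2 h3 h4 h5 h6 h7 h8 h9 h10
    -- The regime may change with `p`, so the two failure bounds are added instead of splitting the
    -- sequence.
    rcases le_total √(k p : ℝ) (lam p) with h11 | h11
    · exact (model_compl_le_of_pred h1 h2 rfl h3 h4 (hlam p).le hc h h8 h9 h5 (h7 h11)).trans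
        le_self_add
    · exact (model_compl_le_of_half h1 h2 rfl h3 h4 (hlam p).le hc h h10 h11 h6).trans
        le_add_self

end Limits

end SparseTensorPCA

end

theorem theorem3p6 :
    ∃ α₀ ∈ Set.Ioo (0 : ℝ) 1, ∀ (t : ℕ) (k : ℕ → ℕ) (lam b : ℕ → ℝ),
      Tendsto k atTop atTop →
      ((t = 2 ∧ ∀ᶠ p : ℕ in atTop, (k p : ℝ) ≤ (p : ℝ) ^ α₀) ∨
        (3 ≤ t ∧ (fun p : ℕ => (k p : ℝ)) =o[atTop]
          fun p : ℕ => (p : ℝ) ^ (((t : ℝ) - 2) / ((t : ℝ) + 2)))) →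
      (∀ p, 0 < lam p) →
      lam =o[atTop] (fun p : ℕ => 1 / √(Real.log ((p : ℝ) / k p)) *
        min ((k p : ℝ) ^ ((t : ℝ) - 1 / 2))
          ((p : ℝ) ^ ((t : ℝ) - 1) / (k p : ℝ) ^ ((t : ℝ) - 3 / 2))) →
      Tendsto (fun p : ℕ => b p /
        (lam p ^ (1 / ((t : ℝ) - 1)) *
          (k p : ℝ) ^ (((t : ℝ) - 2) / (2 * ((t : ℝ) - 1))) *
          Real.log ((p : ℝ) / k p) ^ ((3 * (t : ℝ) - 2) / (2 * ((t : ℝ) - 1)))))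
        atTop atTop →
      Tendsto (fun p : ℕ => b p / √(k p * Real.log ((p : ℝ) / k p))) atTop atTop →
      ∃ c : ℕ → ℝ, Tendsto c atTop atTop ∧
        Tendsto (fun p : ℕ => SparseTensorPCA.model t p (k p)
          (SparseTensorPCA.slowMixing t p (k p) (lam p) (b p) (c p))ᶜ) atTop (𝓝 0) := by
  -- `k ≤ p^(1/101)` is the same as `100 log k ≤ log (p/k)`, the condition used for `t = 2`.
  refine ⟨1 / 101, ⟨by norm_num, by norm_num⟩, ?_⟩
  intro t k lam b hk hcases hlam hlam' hb1 hb2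
  obtain ⟨c, hc, h⟩ := SparseTensorPCA.exists_tendsto_diagonal fun K : ℕ =>
    SparseTensorPCA.tendsto_model_slowMixing_compl hk hcases hlam hlam' hb1 hb2
      (Nat.cast_nonneg K)
  exact ⟨fun p => c p, tendsto_natCast_atTop_atTop.comp hc, h⟩
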